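/- Write $\overline{\log}\, z=\max\{1,\ln z\}$. There are universal constants $C>0$ and $k\in\mathbb N$ such that for all $\eta>0$, $\epsilon>0$, $\gamma\in(0,1]$ and $\vartheta\in(0,1)$ there is a quantum algorithm with the following property. Let $H$ be an $n$-qubit Hamiltonian (a Hermitian matrix on $\mathbb{C}^{2^n}$, $n$ arbitrary) whose spectrum is contained in $[\eta,\pi-\eta]$, let $\lambda_0$ be its ground-state energy (smallest eigenvalue), and let $|\psi_0\rangle$ be a normalized ground state, $H|\psi_0\rangle=\lambda_0|\psi_0\rangle$. Let $U=e^{-iH}$, and let $U_I$ be an $n$-qubit unitary such that $|\phi_0\rangle=U_I|0^n\rangle$ satisfies $|\langle\phi_0|\psi_0\rangle|\ge\gamma$. Given $U$ and $U_I$ as black-box oracles, the algorithm adaptively runs finitely many circuits, each of them started in $|0\rangle|0^n\rangle$ on one ancilla qubit and the $n$ system qubits, and made only of one-qubit gates on the ancilla, of $U$ and $U^\dagger$ controlled by the ancilla, and of $U_I$ on the system, and ended by a measurement of the ancilla. With probability at least $1-\vartheta$ it outputs a real number $a$ with $|a-\lambda_0|\le\epsilon$. With $g=\epsilon^{-1}\gamma^{-2}\,\overline{\log}(\vartheta^{-1})$,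 its worst-case cost is: 1. at most $C\,g\,(\overline{\log}\, g)^k$ queries to controlled $U$ or its inverse in total (that is, $\widetilde{\mathcal O}(\epsilon^{-1}\gamma^{-2}\log\vartheta^{-1})$), and at most $C\,\gamma^{-2}\,(\overline{\log}(\epsilon^{-1}\vartheta^{-1}))^k$ queries to $U_I$ in total (that is, $\mathcal O(\gamma^{-2}\,\mathrm{polylog}(\epsilon^{-1}\vartheta^{-1}))$); 2. one ancilla qubit; 3. at most $C\,g\,(\overline{\log}\, g)^k$ additional one-qubit gates in total; 4. at most $C\,\epsilon^{-1}\,\overline{\log}(\gamma^{-1})$ queries to controlled $U$ or its inverse in any single coherent run (query depth $\mathcal O(\epsilon^{-1}\log\gamma^{-1})$). -/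

import Mathlib

open scoped Matrix Kronecker

noncomputable section

namespace QETU

/-- Labels of the computational basis of `n` qubits. -/
abbrev Bits (n : ℕ) : Type := Fin n → Fin 2

/-- The computational basis state `|0ⁿ⟩`. -/
def zeroState (n : ℕ) : Bits n → ℂ := Pi.single 0 1

/-- The elementary operations of a circuit that acts on one ancilla qubit and a system register.
No other operations are available: in particular there is no second ancilla qubit, and no
multi-qubit gate besides the oracle calls. -/
inductive Gate : Type
  /-- an arbitrary one-qubit gate on the ancilla qubit -/
  | ancilla (V : Matrix.unitaryGroup (Fin 2) ℂ) : Gate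
  /-- the evolution oracle `U`, controlled by the ancilla qubit -/
  | ctrlU : Gate
  /-- the inverse evolution oracle, controlled by the ancilla qubit -/
  | ctrlUinv : Gate
  /-- the oracle `U_I` that prepares the initial guess, on the system register -/
  | prep : Gate

/-- `|0⟩⟨0| ⊗ 1 + |1⟩⟨1| ⊗ U`. -/
def controlled {n : ℕ} (U : Matrix (Bits n) (Bits n) ℂ) :
    Matrix (Fin 2 × Bits n) (Fin 2 × Bits n) ℂ :=
  Matrix.single (0 : Fin 2) (0 : Fin 2) (1 : ℂ) ⊗ₖ (1 : Matrix (Bits n) (Bits n) ℂ) +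
    Matrix.single (1 : Fin 2) (1 : Fin 2) (1 : ℂ) ⊗ₖ U

/-- The matrix of a gate when the oracles are `U` and `UI`
(first tensor factor: ancilla; second: system register). -/
def Gate.toMatrix {n : ℕ} (U UI : Matrix (Bits n) (Bits n) ℂ) :
    Gate → Matrix (Fin 2 × Bits n) (Fin 2 × Bits n) ℂ
  | .ancilla V => (V : Matrix (Fin 2) (Fin 2) ℂ) ⊗ₖ (1 : Matrix (Bits n) (Bits n) ℂ)
  | .ctrlU => controlled U
  | .ctrlUinv => controlled Uᴴ
  | .prep => (1 : Matrix (Fin 2) (Fin 2) ℂ) ⊗ₖ UI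

/-- Is the gate a query to (controlled) `U` or to its inverse? -/
def Gate.isEvolution : Gate → Bool
  | .ctrlU => true
  | .ctrlUinv => true
  | _ => false

/-- Is the gate a query to `U_I`? -/
def Gate.isPrep : Gate → Bool
  | .prep => true
  | _ => false

/-- Is the gate an additional one-qubit gate? -/
def Gate.isOneQubit : Gate → Bool
  | .ancilla _ => true
  | _ => false

/-- A circuit: its gates in the order of application. -/
abbrev Circuit : Type := List Gate

/-- The state after a coherent run of the circuit from `|0⟩|0ⁿ⟩`. -/
def Circuit.finalState {n : ℕ} (U UI : Matrix (Bits n) (Bits n) ℂ) (c : Circuit) :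
    Fin 2 × Bits n → ℂ :=
  c.foldl (fun v g => (g.toMatrix U UI) *ᵥ v) (Pi.single (0, 0) 1)

/-- Born rule: the probability that measuring the ancilla qubit at the end of a run of the circuit
gives the outcome `b`. -/
def Circuit.outcomeProb {n : ℕ} (U UI : Matrix (Bits n) (Bits n) ℂ) (c : Circuit) (b : Fin 2) : ℝ :=
  ∑ x : Bits n, ‖Circuit.finalState U UI c (b, x)‖ ^ 2

/-- An adaptive quantum algorithm with black-box oracles: either output a real number, or run a
circuit from `|0⟩|0ⁿ⟩`, measure the ancilla qubit, discard the state, and continue depending on the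
outcome. The description does not contain the oracles. -/
inductive Algorithm : Type
  | output (a : ℝ) : Algorithm
  | run (c : Circuit) (next : Fin 2 → Algorithm) : Algorithm

/-- The probability that the output of the algorithm lies in `S`, when the oracles are
`U` and `UI`. -/
def Algorithm.prob {n : ℕ} (U UI : Matrix (Bits n) (Bits n) ℂ) (S : Set ℝ) : Algorithm → ℝ
  | .output a => S.indicator 1 a
  | .run c next => ∑ b : Fin 2, Circuit.outcomeProb U UI c b * Algorithm.prob U UI S (next b)

/-- The number of gates of the kind `kind` that the algorithm uses in total, in the worst case over
all sequences of measurement outcomes. -/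
def Algorithm.total (kind : Gate → Bool) : Algorithm → ℕ
  | .output _ => 0
  | .run c next =>
      c.countP kind + max (Algorithm.total kind (next 0)) (Algorithm.total kind (next 1))

/-- The largest number of gates of the kind `kind` in one coherent run (one circuit). -/
def Algorithm.maxPerRun (kind : Gate → Bool) : Algorithm → ℕ
  | .output _ => 0
  | .run c next =>
      max (c.countP kind)
        (max (Algorithm.maxPerRun kind (next 0)) (Algorithm.maxPerRun kind (next 1)))

/-- Total number of queries to (controlled) `U` and its inverse. -/
def Algorithm.evolutionQueries (P : Algorithm) : ℕ := P.total Gate.isEvolution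

/-- Total number of queries to `U_I`. -/
def Algorithm.prepQueries (P : Algorithm) : ℕ := P.total Gate.isPrep

/-- Total number of additional one-qubit gates. -/
def Algorithm.oneQubitGates (P : Algorithm) : ℕ := P.total Gate.isOneQubit

/-- Query depth of `U`: the largest number of queries to (controlled) `U` and its inverse in one
coherent run. -/
def Algorithm.queryDepth (P : Algorithm) : ℕ := P.maxPerRun Gate.isEvolution

/-- The assumptions of the ground-state energy estimation problem: `H` is an `n`-qubit Hamiltonian
with spectrum in `[η, π - η]` and ground-state energy `energy`, `U = exp (-i H)`, and `UI` is a
unitary that prepares from `|0ⁿ⟩` a state whose overlap with a (normalized) ground state `ψ` is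
at least `γ` in absolute value. -/
structure IsEstimationInstance {n : ℕ} (η γ : ℝ) (H U UI : Matrix (Bits n) (Bits n) ℂ)
    (energy : ℝ) (ψ : Bits n → ℂ) : Prop where
  hermitian : H.IsHermitian
  spectrum_subset : spectrum ℝ H ⊆ Set.Icc η (Real.pi - η)
  evolution : U = NormedSpace.exp ((-Complex.I) • H)
  prep_unitary : UI ∈ Matrix.unitaryGroup (Bits n) ℂ
  ground_energy : IsLeast (spectrum ℝ H) energy
  ground_state : H *ᵥ ψ = (energy : ℂ) • ψ
  normalized : star ψ ⬝ᵥ ψ = 1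
  overlap : γ ≤ ‖star (UI *ᵥ zeroState n) ⬝ᵥ ψ‖

/-- The logarithm of cost bounds, `max {1, ln z}`. -/
def lg (z : ℝ) : ℝ := max 1 (Real.log z)

end QETU

end

namespace QETU

open Polynomial ComplexConjugate

/-! ### Polynomials on the unit circle -/

/-! The energy is found by fuzzy bisection, starting from `[0, π]`. If it is known to lie in `[L, L
+ W]`, it is enough to separate the case of the first twentieth of the interval from the case of the
last twentieth: in between, cutting off either end is correct. Each step shrinks the interval by the
factor `19 / 20`, so the number of steps is logarithmic in `ε⁻¹`.

A step applies a polynomial `p (U)` to the prepared state and estimates the squared norm of the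
result. Let `|p|` be at least `1 / 4` at energies within `W / 20` of `L`, and at most `γ / 16` at
energies above `L + 19 / 20 * W`. A low ground energy then gives probability at least `γ ^ 2 / 16`,
by Cauchy–Schwarz against the ground state. If the ground energy is high, so is the whole spectrum,
and the probability is at most `γ ^ 2 / 256`. The two cases differ by a constant factor, so Chernoff
bounds (`prob_countTest_yes`, `prob_countTest_no`) need about `γ⁻²` runs times a logarithm of the
failure probability.

The filter `p` composes two nonnegative kernels. A Fejér kernel of degree of order `1 / W` separates
the two cases with the constants `3 / 4` and `1 / 4`; the probability of a majority among `2 * t`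
Bernoulli trials, as a polynomial in the Fejér value, improves this contrast to `(3 / 4) ^ t`, with
`t` of order `log γ⁻¹`. Degree, and hence query depth, is of order `W⁻¹ * log γ⁻¹`, and no tested
`W` is below `ε`.

One ancilla suffices to apply `p (U)`. Since `|p| < 1` on the circle, Fejér–Riesz gives `q` of the
same degree bound with `|p|² + |q|² = 1` there, and generalized quantum signal processing
(`exists_circuit_of_pair`) peels one controlled `U` and one rotation at a time off the pair `(p,
q)`. -/

theorem infinite_unit_circle : {z : ℂ | ‖z‖ = 1}.Infinite := by
  refine Set.infinite_of_injective_forall_mem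
    (f := fun n : ℕ => Complex.exp ((((n : ℝ) + 1)⁻¹ : ℝ) * Complex.I)) ?_ ?_
  · intro a b hab
    have hpos : ∀ n : ℕ, 0 < ((n : ℝ) + 1)⁻¹ ∧ ((n : ℝ) + 1)⁻¹ ≤ 1 := fun n =>
      ⟨by positivity, inv_le_one_of_one_le₀ (by linarith [n.cast_nonneg (α := ℝ)])⟩
    have hpi := Real.pi_gt_three
    have := congrArg Complex.arg hab
    simp only [Complex.arg_exp_mul_I] at this
    rw [(toIocMod_eq_self _).2, (toIocMod_eq_self _).2] at this
    · simpa using this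
    · constructor <;> linarith [hpos b]
    · constructor <;> linarith [hpos a]
  · intro n
    exact Complex.norm_exp_ofReal_mul_I _

theorem eq_of_eval_eq_on_circle {p q : ℂ[X]} (h : ∀ z : ℂ, ‖z‖ = 1 → p.eval z = q.eval z) :
    p = q :=
  eq_of_infinite_eval_eq p q (infinite_unit_circle.mono fun z hz => h z hz)

/-- The conjugate reciprocal `z ^ n * conj (p (1 / conj z))` of a polynomial of degree at most `n`. -/
noncomputable def conjReciprocal (n : ℕ) (p : ℂ[X]) : ℂ[X] :=
  (p.reflect n).map (starRingEnd ℂ)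

theorem natDegree_conjReciprocal_le {n : ℕ} {p : ℂ[X]} (hp : p.natDegree ≤ n) :
    (conjReciprocal n p).natDegree ≤ n :=
  natDegree_map_le.trans (natDegree_reflect_le.trans (by simp [hp]))

theorem coeff_conjReciprocal {n i : ℕ} (p : ℂ[X]) (hi : i ≤ n) :
    (conjReciprocal n p).coeff i = conj (p.coeff (n - i)) := by
  rw [conjReciprocal, coeff_map, coeff_reflect, revAt_le hi]

theorem mul_conj_of_norm_eq_one {z : ℂ} (hz : ‖z‖ = 1) : z * conj z = 1 := by
  rw [Complex.mul_conj, Complex.normSq_eq_norm_sq, hz]; simp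

theorem eval_conjReciprocal {n : ℕ} {p : ℂ[X]} (hp : p.natDegree ≤ n) {z : ℂ} (hz : ‖z‖ = 1) :
    (conjReciprocal n p).eval z = z ^ n * conj (p.eval z) := by
  have hz1 := mul_conj_of_norm_eq_one hz
  let : Invertible z := ⟨conj z, by rw [mul_comm, hz1], hz1⟩
  have h := eval₂_reflect_mul_pow (RingHom.id ℂ) z n p hp
  have hinv : ⅟z = conj z := rfl
  rw [hinv] at h
  change eval (conj z) (reflect n p) * z ^ n = eval z p at h
  rw [conjReciprocal, ← h, eval_map, map_mul, map_pow, mul_left_comm, ← mul_pow, hz1, one_pow,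
    mul_one, ← Complex.conj_conj z, eval₂_hom, Complex.conj_conj]

theorem eval_conjReciprocal_eq_zero {n : ℕ} {p : ℂ[X]} (hp : p.natDegree ≤ n) {α : ℂ} (hα : α ≠ 0)
    (h : p.eval α = 0) : (conjReciprocal n p).eval (conj α)⁻¹ = 0 := by
  let := invertibleOfNonzero hα
  have h' : eval α⁻¹ (reflect n p) = 0 := by
    have := (eval₂_reflect_eq_zero_iff (RingHom.id ℂ) α n p hp).2 h
    rwa [invOf_eq_inv] at this
  rw [conjReciprocal, eval_map, ← map_inv₀, eval₂_hom, h', map_zero]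

/-- **Fejér–Riesz theorem** for strictly positive trigonometric polynomials. -/
theorem fejer_riesz (d : ℕ) (p : ℂ[X]) (hdeg : p.natDegree ≤ 2 * d)
    (hpos : ∀ z : ℂ, ‖z‖ = 1 → ∃ ρ : ℝ, 0 < ρ ∧ p.eval z = ρ * z ^ d) :
    ∃ q : ℂ[X], q.natDegree ≤ d ∧
      ∀ z : ℂ, ‖z‖ = 1 → p.eval z = ((‖q.eval z‖ ^ 2 : ℝ) : ℂ) * z ^ d := by
  induction d generalizing p with
  | zero =>
    obtain ⟨ρ, hρ, h1⟩ := hpos 1 (by simp)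
    obtain ⟨c, rfl⟩ := natDegree_eq_zero.1 (Nat.le_zero.1 hdeg)
    simp only [eval_C, pow_zero, mul_one] at h1
    refine ⟨C ((√ρ : ℝ) : ℂ), by simp, fun z _ => ?_⟩
    rw [eval_C, eval_C, Complex.norm_real, Real.norm_eq_abs, sq_abs, Real.sq_sqrt hρ.le, h1]
    simp
  | succ d ih =>
    -- `p z / z ^ (d + 1)` is real on the circle, so `p` is its own conjugate reciprocal and its
    -- nonzero roots come in pairs `α`, `1 / conj α`.
    have hself : conjReciprocal (2 * (d + 1)) p = p := by
      refine eq_of_eval_eq_on_circle fun z hz => ?_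
      obtain ⟨ρ, -, h⟩ := hpos z hz
      have hz1 : z ^ (d + 1) * conj z ^ (d + 1) = 1 := by
        rw [← mul_pow, mul_conj_of_norm_eq_one hz, one_pow]
      rw [eval_conjReciprocal hdeg hz, h, map_mul, map_pow, Complex.conj_ofReal]
      linear_combination (ρ : ℂ) * z ^ (d + 1) * hz1
    -- A vanishing constant coefficient forces a vanishing top coefficient by self-reciprocity, so
    -- dividing by `X` lowers the degree bound by two.
    by_cases h0 : p.coeff 0 = 0
    · obtain ⟨r, rfl⟩ := X_dvd_iff.2 h0
      have htop : (X * r).coeff (2 * (d + 1)) = 0 := by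
        rw [← hself, coeff_conjReciprocal _ le_rfl, Nat.sub_self, h0, map_zero]
      have hr : r.natDegree ≤ 2 * d := by
        rw [natDegree_le_iff_coeff_eq_zero]
        intro N hN
        rw [← coeff_X_mul]
        rcases (Nat.succ_le_of_lt hN).eq_or_lt with h | h
        · rw [← h]; exact htop
        · exact coeff_eq_zero_of_natDegree_lt (by omega)
      have hrz : ∀ z : ℂ, ‖z‖ = 1 → z ≠ 0 := fun z hz h => by simp [h] at hz
      obtain ⟨q, hq, hq'⟩ := ih r hr fun z hz => by
        obtain ⟨ρ, hρ, h⟩ := hpos z hz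
        refine ⟨ρ, hρ, mul_left_cancel₀ (hrz z hz) ?_⟩
        rw [eval_mul, eval_X] at h
        rw [h]; ring
      refine ⟨q, by omega, fun z hz => ?_⟩
      rw [eval_mul, eval_X, hq' z hz]; ring
    · have hp0 : p.degree ≠ 0 := fun h => by
        obtain ⟨c, rfl⟩ := natDegree_eq_zero.1 (natDegree_eq_of_degree_eq_some h)
        apply h0
        rw [← hself, coeff_conjReciprocal _ (Nat.zero_le _), coeff_C]
        simp
      obtain ⟨α, hα⟩ := IsAlgClosed.exists_root p hp0
      have hα0 : α ≠ 0 := by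
        rintro rfl
        exact h0 (by rw [coeff_zero_eq_eval_zero]; exact hα)
      have hα1 : ‖α‖ ≠ 1 := fun h => by
        obtain ⟨ρ, hρ, h'⟩ := hpos α h
        rw [hα.eq_zero] at h'
        simp [hρ.ne', hα0] at h'
      -- Strict positivity keeps `α` off the circle, so its mirror image `β` is a different root and
      -- both linear factors split off.
      obtain ⟨β, hβ⟩ : ∃ β, β = (conj α)⁻¹ := ⟨_, rfl⟩
      have hβα : β ≠ α := fun h => by
        apply hα1
        have h2 : α * conj α = 1 := by
          rw [mul_comm, ← inv_inv (conj α), ← hβ, h, inv_mul_cancel₀ hα0]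
        rw [Complex.mul_conj, Complex.normSq_eq_norm_sq] at h2
        have h3 : ‖α‖ ^ 2 = 1 := by exact_mod_cast h2
        nlinarith [norm_nonneg α]
      have hβroot : p.eval β = 0 := by
        rw [hβ, ← hself]; exact eval_conjReciprocal_eq_zero hdeg hα0 hα
      obtain ⟨p₁, rfl⟩ := dvd_iff_isRoot.2 hα
      have hp₁ : p₁.IsRoot β := by
        rw [eval_mul, eval_sub, eval_X, eval_C] at hβroot
        exact (mul_eq_zero.1 hβroot).resolve_left (sub_ne_zero.2 hβα)
      obtain ⟨p₂, rfl⟩ := dvd_iff_isRoot.2 hp₁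
      have hp₂0 : p₂ ≠ 0 := by rintro rfl; simp at h0
      have hdeg₂ : p₂.natDegree ≤ 2 * d := by
        rw [natDegree_mul (X_sub_C_ne_zero _) (mul_ne_zero (X_sub_C_ne_zero _) hp₂0),
          natDegree_mul (X_sub_C_ne_zero _) hp₂0, natDegree_X_sub_C, natDegree_X_sub_C] at hdeg
        omega
      -- The pair of factors is a positive function times `-β * z`. The constant `-β` goes into the
      -- remaining polynomial, which keeps the positivity, and `X - α` goes into `q`.
      have key : ∀ z : ℂ, ‖z‖ = 1 →
          (z - α) * (z - β) = ((‖z - α‖ ^ 2 : ℝ) : ℂ) * (-β) * z := fun z hz => by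
        have hz1 := mul_conj_of_norm_eq_one hz
        have hb : β * conj α = 1 := by
          rw [hβ]; exact inv_mul_cancel₀ (by simpa using hα0)
        rw [← Complex.normSq_eq_norm_sq, ← Complex.mul_conj, map_sub]
        linear_combination (z - α) * β * hz1 - (z - α) * z * hb
      obtain ⟨q, hq, hq'⟩ := ih (C (-β) * p₂) ((natDegree_C_mul_le _ _).trans hdeg₂) fun z hz => by
        obtain ⟨ρ, hρ, h⟩ := hpos z hz
        have hz0 : z ≠ 0 := fun h => by simp [h] at hz
        have hza : z - α ≠ 0 := fun h => hα1 (by rw [← sub_eq_zero.1 h]; exact hz)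
        have hpos' : 0 < ‖z - α‖ ^ 2 := by positivity
        refine ⟨ρ / ‖z - α‖ ^ 2, by positivity, ?_⟩
        have hne : ((‖z - α‖ ^ 2 : ℝ) : ℂ) ≠ 0 := by exact_mod_cast hpos'.ne'
        simp only [eval_mul, eval_sub, eval_X, eval_C] at h ⊢
        rw [← mul_assoc, key z hz] at h
        apply mul_left_cancel₀ hz0
        apply mul_left_cancel₀ hne
        rw [Complex.ofReal_div]
        have e : ((‖z - α‖ ^ 2 : ℝ) : ℂ) * ((ρ : ℂ) / ((‖z - α‖ ^ 2 : ℝ) : ℂ)) = ρ :=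
          mul_div_cancel₀ _ hne
        linear_combination h - z ^ (d + 1) * e
      refine ⟨(X - C α) * q, ?_, fun z hz => ?_⟩
      · refine natDegree_mul_le.trans ?_
        rw [natDegree_X_sub_C]; omega
      · have h := hq' z hz
        simp only [eval_mul, eval_sub, eval_X, eval_C] at h ⊢
        rw [← mul_assoc, key z hz, norm_mul, mul_pow, Complex.ofReal_mul, pow_succ z]
        linear_combination ((‖z - α‖ ^ 2 : ℝ) : ℂ) * z * h

/-- Multiplied by `z ^ d`, the function `1 - |p|²` on the circle becomes the polynomial `X ^ d - p *
conjReciprocal d p`, to which Fejér–Riesz applies; strictness of the bound on `p` gives the strict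
positivity needed there. -/
theorem exists_complementary_polynomial (d : ℕ) (p : ℂ[X]) (hdeg : p.natDegree ≤ d)
    (hlt : ∀ z : ℂ, ‖z‖ = 1 → ‖p.eval z‖ < 1) :
    ∃ q : ℂ[X], q.natDegree ≤ d ∧ ∀ z : ℂ, ‖z‖ = 1 → ‖p.eval z‖ ^ 2 + ‖q.eval z‖ ^ 2 = 1 := by
  have heval : ∀ z : ℂ, ‖z‖ = 1 → (X ^ d - p * conjReciprocal d p).eval z =
      ((1 - ‖p.eval z‖ ^ 2 : ℝ) : ℂ) * z ^ d := fun z hz => by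
    rw [eval_sub, eval_pow, eval_X, eval_mul, eval_conjReciprocal hdeg hz, mul_left_comm,
      Complex.mul_conj, Complex.normSq_eq_norm_sq]
    push_cast; ring
  obtain ⟨q, hq, hq'⟩ := fejer_riesz d (X ^ d - p * conjReciprocal d p) (by
      refine (natDegree_sub_le _ _).trans (max_le (by simp; omega) ?_)
      exact natDegree_mul_le.trans (by linarith [natDegree_conjReciprocal_le hdeg]))
    fun z hz => ⟨1 - ‖p.eval z‖ ^ 2, by nlinarith [hlt z hz, norm_nonneg (p.eval z)], heval z hz⟩
  refine ⟨q, hq, fun z hz => ?_⟩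
  have hz0 : z ^ d ≠ 0 := pow_ne_zero _ fun h => by simp [h] at hz
  have h := mul_right_cancel₀ hz0 ((heval z hz).symm.trans (hq' z hz))
  have : 1 - ‖p.eval z‖ ^ 2 = ‖q.eval z‖ ^ 2 := by exact_mod_cast h
  linarith

/-! ### Action of the gates on the two branches of the ancilla -/

/-- The state whose branch with ancilla value `b` is `f b`. -/
def branches {n : ℕ} (f : Fin 2 → Bits n → ℂ) : Fin 2 × Bits n → ℂ := fun p => f p.1 p.2

theorem kronecker_mulVec_branches {n : ℕ} (A : Matrix (Fin 2) (Fin 2) ℂ)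
    (B : Matrix (Bits n) (Bits n) ℂ) (f : Fin 2 → Bits n → ℂ) :
    (A ⊗ₖ B) *ᵥ branches f = branches fun b => ∑ b', A b b' • (B *ᵥ f b') := by
  ext ⟨b, x⟩
  simp only [branches, Matrix.mulVec, dotProduct, Fintype.sum_prod_type, Matrix.kronecker_apply,
    Finset.sum_apply, Pi.smul_apply, smul_eq_mul, Finset.mul_sum, mul_assoc]

theorem controlled_mulVec_branches {n : ℕ} (U : Matrix (Bits n) (Bits n) ℂ)
    (f : Fin 2 → Bits n → ℂ) :
    controlled U *ᵥ branches f = branches ![f 0, U *ᵥ f 1] := by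
  rw [controlled, Matrix.add_mulVec, kronecker_mulVec_branches, kronecker_mulVec_branches]
  ext ⟨b, x⟩
  fin_cases b <;> simp [branches, Fin.sum_univ_two, Matrix.single]

theorem ancilla_mulVec_branches {n : ℕ} (U UI : Matrix (Bits n) (Bits n) ℂ)
    (V : Matrix.unitaryGroup (Fin 2) ℂ) (f : Fin 2 → Bits n → ℂ) :
    (Gate.ancilla V).toMatrix U UI *ᵥ branches f =
      branches fun b => ∑ b', (V : Matrix (Fin 2) (Fin 2) ℂ) b b' • f b' := by
  rw [Gate.toMatrix, kronecker_mulVec_branches]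
  simp

theorem prep_mulVec_branches {n : ℕ} (U UI : Matrix (Bits n) (Bits n) ℂ)
    (f : Fin 2 → Bits n → ℂ) :
    Gate.prep.toMatrix U UI *ᵥ branches f = branches fun b => UI *ᵥ f b := by
  rw [Gate.toMatrix, kronecker_mulVec_branches]
  congr 1
  ext1 b
  simp [Matrix.one_apply]

theorem zeroState_eq_branches (n : ℕ) :
    (Pi.single (0, 0) 1 : Fin 2 × Bits n → ℂ) = branches ![zeroState n, 0] := by
  ext ⟨b, x⟩
  fin_cases b <;> simp [branches, zeroState, Pi.single_apply]

/-! ### One-qubit unitaries -/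

theorem exists_unitary_col (a b : ℂ) (h : a ≠ 0 ∨ b ≠ 0) :
    ∃ (V : Matrix.unitaryGroup (Fin 2) ℂ) (r : ℝ), r = (√(‖a‖ ^ 2 + ‖b‖ ^ 2))⁻¹ ∧
      (V : Matrix (Fin 2) (Fin 2) ℂ) = !![r * a, -(r * conj b); r * b, r * conj a] := by
  obtain ⟨r, hr⟩ : ∃ r : ℝ, r = (√(‖a‖ ^ 2 + ‖b‖ ^ 2))⁻¹ := ⟨_, rfl⟩
  have hpos : 0 < ‖a‖ ^ 2 + ‖b‖ ^ 2 := by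
    rcases h with h | h
    · have := norm_pos_iff.2 h; positivity
    · have := norm_pos_iff.2 h; positivity
  have hr2 : (r : ℂ) * r * (a * conj a + b * conj b) = 1 := by
    have h1 : r * r * (‖a‖ ^ 2 + ‖b‖ ^ 2) = 1 := by
      rw [hr, ← mul_inv, Real.mul_self_sqrt hpos.le, inv_mul_cancel₀ hpos.ne']
    rw [Complex.mul_conj, Complex.mul_conj, Complex.normSq_eq_norm_sq, Complex.normSq_eq_norm_sq]
    exact_mod_cast h1
  refine ⟨⟨!![r * a, -(r * conj b); r * b, r * conj a], ?_⟩, r, hr, rfl⟩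
  rw [Matrix.mem_unitaryGroup_iff']
  ext i j
  fin_cases i <;> fin_cases j <;>
    simp [Matrix.mul_apply, Fin.sum_univ_two, Matrix.star_apply] <;>
    first | ring1 | linear_combination hr2

/-- Orthogonal vectors `u`, `w` are turned by a unitary into the axes. -/
theorem exists_unitary_axes (u w : Fin 2 → ℂ) (h : w 0 * conj (u 0) + w 1 * conj (u 1) = 0) :
    ∃ V : Matrix.unitaryGroup (Fin 2) ℂ,
      ∑ b, conj ((V : Matrix (Fin 2) (Fin 2) ℂ) b 1) * u b = 0 ∧
      ∑ b, conj ((V : Matrix (Fin 2) (Fin 2) ℂ) b 0) * w b = 0 := by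
  by_cases hu : u 0 ≠ 0 ∨ u 1 ≠ 0
  · obtain ⟨V, r, -, hV⟩ := exists_unitary_col _ _ hu
    refine ⟨V, ?_, ?_⟩ <;> rw [hV] <;> simp [Fin.sum_univ_two]
    · ring
    · linear_combination (r : ℂ) * h
  · push Not at hu
    -- With `u = 0` only the second condition matters, and `(conj (w 1), -conj (w 0))` is orthogonal
    -- to `w`.
    by_cases hw : conj (w 1) ≠ 0 ∨ -conj (w 0) ≠ 0
    · obtain ⟨V, r, -, hV⟩ := exists_unitary_col _ _ hw
      refine ⟨V, ?_, ?_⟩ <;> rw [hV] <;> simp [Fin.sum_univ_two, hu.1, hu.2]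
      ring
    · push Not at hw
      simp only [map_eq_zero, neg_eq_zero] at hw
      exact ⟨1, by simp [Fin.sum_univ_two, hu.1, hu.2], by simp [Fin.sum_univ_two, hw.1, hw.2]⟩

theorem exists_unitary_first_col (c : Fin 2 → ℂ) (h : ‖c 0‖ ^ 2 + ‖c 1‖ ^ 2 = 1) :
    ∃ V : Matrix.unitaryGroup (Fin 2) ℂ, ∀ b, (V : Matrix (Fin 2) (Fin 2) ℂ) b 0 = c b := by
  have h0 : c 0 ≠ 0 ∨ c 1 ≠ 0 := by
    by_contra! hc
    simp [hc.1, hc.2] at h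
  obtain ⟨V, r, hr, hV⟩ := exists_unitary_col _ _ h0
  rw [h, Real.sqrt_one, inv_one] at hr
  refine ⟨V, fun b => ?_⟩
  rw [hV, hr]
  fin_cases b <;> simp

theorem sum_norm_sq_conjTranspose_mul (V : Matrix.unitaryGroup (Fin 2) ℂ) (c : Fin 2 → ℂ) :
    ∑ b, ‖∑ b', conj ((V : Matrix (Fin 2) (Fin 2) ℂ) b' b) * c b'‖ ^ 2 = ∑ b, ‖c b‖ ^ 2 := by
  have hV : ∀ i j, ∑ b, (V : Matrix (Fin 2) (Fin 2) ℂ) i b *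
      conj ((V : Matrix (Fin 2) (Fin 2) ℂ) j b) = if i = j then 1 else 0 := fun i j => by
    have := congrFun (congrFun (Matrix.mem_unitaryGroup_iff.1 V.2) i) j
    simpa [Matrix.mul_apply, Matrix.star_apply, Matrix.one_apply] using this
  have h00 := hV 0 0
  have h01 := hV 0 1
  have h10 := hV 1 0
  have h11 := hV 1 1
  simp only [Fin.sum_univ_two] at *
  have : ∀ z : ℂ, ((‖z‖ ^ 2 : ℝ) : ℂ) = z * conj z := fun z => by
    rw [Complex.mul_conj, Complex.normSq_eq_norm_sq]
  rw [← Complex.ofReal_inj, Complex.ofReal_add, Complex.ofReal_add, this, this, this, this]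
  simp only [map_add, map_mul, Complex.conj_conj]
  simp at h00 h01 h10 h11
  linear_combination c 0 * conj (c 0) * h00 + c 1 * conj (c 1) * h11
    + c 1 * conj (c 0) * h01 + c 0 * conj (c 1) * h10

/-! ### Quantum signal processing -/

/-- **Generalized quantum signal processing**: a pair of polynomials of degree at most `D` whose
values on the unit circle are unit vectors is realized by a circuit with `D` controlled evolutions
and `D + 1` gates on the ancilla. -/
theorem exists_circuit_of_pair (D : ℕ) (f : Fin 2 → ℂ[X]) (hdeg : ∀ b, (f b).natDegree ≤ D)
    (hnorm : ∀ z : ℂ, ‖z‖ = 1 → ‖(f 0).eval z‖ ^ 2 + ‖(f 1).eval z‖ ^ 2 = 1) :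
    ∃ c : Circuit, c.countP Gate.isEvolution = D ∧ c.countP Gate.isPrep = 0 ∧
      c.countP Gate.isOneQubit = D + 1 ∧
      ∀ (n : ℕ) (U UI : Matrix (Bits n) (Bits n) ℂ) (φ : Bits n → ℂ),
        c.foldl (fun v g => g.toMatrix U UI *ᵥ v) (branches ![φ, 0]) =
          branches fun b => aeval U (f b) *ᵥ φ := by
  induction D generalizing f with
  | zero =>
    have hC : ∀ b, f b = C ((f b).coeff 0) := fun b =>
      eq_C_of_natDegree_eq_zero (Nat.le_zero.1 (hdeg b))
    have h1 := hnorm 1 (by simp)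
    rw [hC 0, hC 1, eval_C, eval_C] at h1
    obtain ⟨V, hV⟩ := exists_unitary_first_col (fun b => (f b).coeff 0) h1
    refine ⟨[Gate.ancilla V], rfl, rfl, rfl, fun n U UI φ => ?_⟩
    rw [List.foldl_cons, List.foldl_nil, ancilla_mulVec_branches]
    congr 1
    ext b x
    rw [hC b, aeval_C, Algebra.algebraMap_eq_smul_one, Matrix.smul_mulVec, Matrix.one_mulVec]
    simp [Fin.sum_univ_two, hV]
  | succ D ih =>
    -- Normalization on the circle, as a polynomial identity. Its coefficient of degree `2 * (D +
    -- 1)` vanishes, which makes the vectors of leading and of constant coefficients orthogonal.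
    have hid : f 0 * conjReciprocal (D + 1) (f 0) + f 1 * conjReciprocal (D + 1) (f 1) =
        X ^ (D + 1) := by
      refine eq_of_eval_eq_on_circle fun z hz => ?_
      have h := congrArg (Complex.ofReal) (hnorm z hz)
      rw [eval_add, eval_mul, eval_mul, eval_conjReciprocal (hdeg 0) hz,
        eval_conjReciprocal (hdeg 1) hz, eval_pow, eval_X, mul_left_comm, mul_left_comm (eval z _),
        Complex.mul_conj, Complex.mul_conj, Complex.normSq_eq_norm_sq, Complex.normSq_eq_norm_sq,
        ← mul_add, ← Complex.ofReal_add, h, Complex.ofReal_one, mul_one]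
    have horth : (f 0).coeff (D + 1) * conj ((f 0).coeff 0) +
        (f 1).coeff (D + 1) * conj ((f 1).coeff 0) = 0 := by
      have h := congrArg (fun p => p.coeff ((D + 1) + (D + 1))) hid
      simp only [coeff_add] at h
      rw [coeff_mul_add_eq_of_natDegree_le (hdeg 0) (natDegree_conjReciprocal_le (hdeg 0)),
        coeff_mul_add_eq_of_natDegree_le (hdeg 1) (natDegree_conjReciprocal_le (hdeg 1)),
        coeff_conjReciprocal _ le_rfl, coeff_conjReciprocal _ le_rfl, Nat.sub_self,
        coeff_X_pow, if_neg (by omega)] at h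
      exact h
    -- After undoing `V`, the branch `0` has lost its leading coefficient and the branch `1` its
    -- constant one. Dividing the latter by `X`, that is, undoing a controlled `U`, leaves a pair of
    -- degree at most `D`.
    obtain ⟨V, hV1, hV0⟩ := exists_unitary_axes (fun b => (f b).coeff 0)
      (fun b => (f b).coeff (D + 1)) horth
    obtain ⟨g, hg⟩ : ∃ g : Fin 2 → ℂ[X], ∀ b, g b =
        ∑ b', C (conj ((V : Matrix (Fin 2) (Fin 2) ℂ) b' b)) * f b' := ⟨_, fun _ => rfl⟩
    have hgdeg : ∀ b, (g b).natDegree ≤ D + 1 := fun b => by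
      rw [hg]
      exact natDegree_sum_le_of_forall_le _ _ fun i _ =>
        (natDegree_C_mul_le _ _).trans (hdeg i)
    have hg0 : (g 0).natDegree ≤ D := by
      rw [natDegree_le_iff_coeff_eq_zero]
      intro N hN
      rcases (Nat.succ_le_of_lt hN).eq_or_lt with h | h
      · rw [hg, ← h]
        simpa [finsetSum_coeff] using hV0
      · exact coeff_eq_zero_of_natDegree_lt (lt_of_le_of_lt (hgdeg 0) h)
    obtain ⟨r, hr⟩ : X ∣ g 1 := X_dvd_iff.2 (by
      rw [hg]; simpa [finsetSum_coeff] using hV1)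
    have hrdeg : r.natDegree ≤ D := by
      rw [natDegree_le_iff_coeff_eq_zero]
      intro N hN
      rw [← coeff_X_mul, ← hr]
      exact coeff_eq_zero_of_natDegree_lt (lt_of_le_of_lt (hgdeg 1) (by omega))
    have hfg : ∀ b, f b = ∑ b', C ((V : Matrix (Fin 2) (Fin 2) ℂ) b b') * g b' := fun b => by
      have hVV : ∀ i j, ∑ b, (V : Matrix (Fin 2) (Fin 2) ℂ) i b *
          conj ((V : Matrix (Fin 2) (Fin 2) ℂ) j b) = if i = j then 1 else 0 := fun i j => by
        have := congrFun (congrFun (Matrix.mem_unitaryGroup_iff.1 V.2) i) j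
        simpa [Matrix.mul_apply, Matrix.star_apply, Matrix.one_apply] using this
      simp only [hg, Finset.mul_sum, ← mul_assoc, ← C_mul]
      rw [Finset.sum_comm]
      simp only [← Finset.sum_mul, ← map_sum, hVV]
      simp
    obtain ⟨c, hc1, hc2, hc3, hc⟩ := ih ![g 0, r]
      (fun b => by fin_cases b; exacts [hg0, hrdeg]) fun z hz => by
        have h := sum_norm_sq_conjTranspose_mul V fun b => (f b).eval z
        rw [Fin.sum_univ_two (fun b => ‖(f b).eval z‖ ^ 2), hnorm z hz, Fin.sum_univ_two] at h
        have hge : ∀ b, (g b).eval z = ∑ b', conj ((V : Matrix (Fin 2) (Fin 2) ℂ) b' b) *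
            (f b').eval z := fun b => by rw [hg]; simp
        rw [← hge, ← hge, hr, eval_mul, eval_X, norm_mul, hz, one_mul] at h
        exact h
    refine ⟨c ++ [Gate.ctrlU, Gate.ancilla V], ?_, ?_, ?_, fun n U UI φ => ?_⟩
    · rw [List.countP_append, hc1]; rfl
    · simp [hc2, Gate.isPrep]
    · simp [hc3, Gate.isOneQubit, List.countP_cons]
    · have hU : Gate.ctrlU.toMatrix U UI = controlled U := rfl
      rw [List.foldl_append, hc, List.foldl_cons, List.foldl_cons, List.foldl_nil, hU,
        controlled_mulVec_branches, ancilla_mulVec_branches]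
      congr 1
      ext1 b
      rw [hfg b, map_sum, Matrix.sum_mulVec]
      refine Finset.sum_congr rfl fun b' _ => ?_
      rw [map_mul, aeval_C, ← Algebra.smul_def, Matrix.smul_mulVec]
      congr 1
      fin_cases b'
      · simp
      · simp [hr]

/-- A polynomial of modulus less than one on the unit circle is applied to the prepared state by a
circuit. -/
theorem exists_circuit (D : ℕ) (p : ℂ[X]) (hdeg : p.natDegree ≤ D)
    (hlt : ∀ z : ℂ, ‖z‖ = 1 → ‖p.eval z‖ < 1) :
    ∃ c : Circuit, c.countP Gate.isEvolution = D ∧ c.countP Gate.isPrep = 1 ∧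
      c.countP Gate.isOneQubit = D + 1 ∧
      ∀ (n : ℕ) (U UI : Matrix (Bits n) (Bits n) ℂ),
        c.outcomeProb U UI 0 = ∑ x, ‖(aeval U p *ᵥ (UI *ᵥ zeroState n)) x‖ ^ 2 := by
  obtain ⟨q, hq, hpq⟩ := exists_complementary_polynomial D p hdeg hlt
  obtain ⟨c, hc1, hc2, hc3, hc⟩ := exists_circuit_of_pair D ![p, q]
    (fun b => by fin_cases b; exacts [hdeg, hq]) hpq
  refine ⟨Gate.prep :: c, ?_, ?_, ?_, fun n U UI => ?_⟩
  · rw [List.countP_cons, hc1]; rfl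
  · rw [List.countP_cons, hc2]; rfl
  · rw [List.countP_cons, hc3]; rfl
  · have h : Circuit.finalState U UI (Gate.prep :: c) = branches fun b =>
        aeval U ((![p, q] : Fin 2 → ℂ[X]) b) *ᵥ (UI *ᵥ zeroState n) := by
      rw [← hc, Circuit.finalState, List.foldl_cons, zeroState_eq_branches, prep_mulVec_branches]
      congr 2
      ext b x
      fin_cases b <;> simp
    rw [Circuit.outcomeProb, h]
    rfl

/-! ### Unitarity and the Born rule -/

theorem ofReal_sum_norm_sq {ι : Type*} [Fintype ι] (v : ι → ℂ) :
    ((∑ i, ‖v i‖ ^ 2 : ℝ) : ℂ) = star v ⬝ᵥ v := by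
  simp only [dotProduct, Pi.star_apply, RCLike.star_def, Complex.ofReal_sum]
  refine Finset.sum_congr rfl fun i _ => ?_
  rw [mul_comm, Complex.mul_conj, Complex.normSq_eq_norm_sq]

theorem dotProduct_unitary_mulVec {ι : Type*} [Fintype ι] [DecidableEq ι] {V : Matrix ι ι ℂ}
    (hV : V ∈ Matrix.unitaryGroup ι ℂ) (v w : ι → ℂ) :
    star (V *ᵥ v) ⬝ᵥ (V *ᵥ w) = star v ⬝ᵥ w := by
  have h := Matrix.mem_unitaryGroup_iff'.1 hV
  rw [Matrix.star_eq_conjTranspose] at h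
  rw [Matrix.star_mulVec, Matrix.dotProduct_mulVec, Matrix.vecMul_vecMul, h, Matrix.vecMul_one]

theorem sum_norm_sq_unitary_mulVec {ι : Type*} [Fintype ι] [DecidableEq ι] {V : Matrix ι ι ℂ}
    (hV : V ∈ Matrix.unitaryGroup ι ℂ) (v : ι → ℂ) :
    ∑ i, ‖(V *ᵥ v) i‖ ^ 2 = ∑ i, ‖v i‖ ^ 2 := by
  rw [← Complex.ofReal_inj, ofReal_sum_norm_sq, ofReal_sum_norm_sq, dotProduct_unitary_mulVec hV]

theorem sum_norm_sq_controlled {n : ℕ} {U : Matrix (Bits n) (Bits n) ℂ}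
    (hU : U ∈ Matrix.unitaryGroup (Bits n) ℂ) (v : Fin 2 × Bits n → ℂ) :
    ∑ p, ‖(controlled U *ᵥ v) p‖ ^ 2 = ∑ p, ‖v p‖ ^ 2 := by
  have hv : v = branches fun b x => v (b, x) := rfl
  rw [hv, controlled_mulVec_branches]
  simp [Fintype.sum_prod_type, Fin.sum_univ_two, branches, sum_norm_sq_unitary_mulVec hU]

theorem sum_norm_sq_gate {n : ℕ} {U UI : Matrix (Bits n) (Bits n) ℂ}
    (hU : U ∈ Matrix.unitaryGroup (Bits n) ℂ) (hUI : UI ∈ Matrix.unitaryGroup (Bits n) ℂ)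
    (g : Gate) (v : Fin 2 × Bits n → ℂ) :
    ∑ p, ‖(g.toMatrix U UI *ᵥ v) p‖ ^ 2 = ∑ p, ‖v p‖ ^ 2 := by
  cases g with
  | ancilla V => exact sum_norm_sq_unitary_mulVec (Matrix.kronecker_mem_unitary V.2 (one_mem _)) v
  | ctrlU => exact sum_norm_sq_controlled hU v
  | ctrlUinv => exact sum_norm_sq_controlled (Unitary.star_mem hU) v
  | prep => exact sum_norm_sq_unitary_mulVec (Matrix.kronecker_mem_unitary (one_mem _) hUI) v

theorem outcomeProb_add {n : ℕ} {U UI : Matrix (Bits n) (Bits n) ℂ}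
    (hU : U ∈ Matrix.unitaryGroup (Bits n) ℂ) (hUI : UI ∈ Matrix.unitaryGroup (Bits n) ℂ)
    (c : Circuit) : c.outcomeProb U UI 0 + c.outcomeProb U UI 1 = 1 := by
  have h : ∀ v : Fin 2 × Bits n → ℂ,
      ∑ p, ‖(c.foldl (fun v g => g.toMatrix U UI *ᵥ v) v) p‖ ^ 2 = ∑ p, ‖v p‖ ^ 2 := by
    induction c with
    | nil => exact fun v => rfl
    | cons g c ih => exact fun v => by rw [List.foldl_cons, ih, sum_norm_sq_gate hU hUI]
  have h1 := h (Pi.single (0, 0) 1)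
  rw [Fintype.sum_prod_type, Fin.sum_univ_two] at h1
  rw [Circuit.outcomeProb, Circuit.outcomeProb, Circuit.finalState, h1,
    Finset.sum_eq_single ((0, 0) : Fin 2 × Bits n)]
  · simp
  · intro p _ hp
    simp [Pi.single_eq_of_ne hp]
  · simp

theorem outcomeProb_nonneg {n : ℕ} (U UI : Matrix (Bits n) (Bits n) ℂ) (c : Circuit) (b : Fin 2) :
    0 ≤ c.outcomeProb U UI b :=
  Finset.sum_nonneg fun _ _ => by positivity

theorem prob_nonneg {n : ℕ} (U UI : Matrix (Bits n) (Bits n) ℂ) (S : Set ℝ) (P : Algorithm) :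
    0 ≤ P.prob U UI S := by
  induction P with
  | output a => exact Set.indicator_nonneg (fun _ _ => zero_le_one) _
  | run c next ih =>
    exact Finset.sum_nonneg fun b _ => mul_nonneg (outcomeProb_nonneg U UI c b) (ih b)

theorem prob_mono {n : ℕ} (U UI : Matrix (Bits n) (Bits n) ℂ) (P : Algorithm) {S T : Set ℝ}
    (hST : S ⊆ T) : P.prob U UI S ≤ P.prob U UI T := by
  induction P with
  | output a => exact Set.indicator_le_indicator_of_subset hST (fun _ => zero_le_one) a
  | run c next ih =>
    exact Finset.sum_le_sum fun b _ =>
      mul_le_mul_of_nonneg_left (ih b) (outcomeProb_nonneg U UI c b)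

theorem prob_le_one {n : ℕ} {U UI : Matrix (Bits n) (Bits n) ℂ}
    (hU : U ∈ Matrix.unitaryGroup (Bits n) ℂ) (hUI : UI ∈ Matrix.unitaryGroup (Bits n) ℂ)
    (S : Set ℝ) (P : Algorithm) : P.prob U UI S ≤ 1 := by
  induction P with
  | output a =>
    rw [Algorithm.prob]
    exact Set.indicator_le_self' (f := (1 : ℝ → ℝ)) (fun _ _ => zero_le_one) a
  | run c next ih =>
    rw [Algorithm.prob, Fin.sum_univ_two, ← outcomeProb_add hU hUI c]
    exact add_le_add (mul_le_of_le_one_right (outcomeProb_nonneg U UI c 0) (ih 0))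
      (mul_le_of_le_one_right (outcomeProb_nonneg U UI c 1) (ih 1))

/-! ### Polynomials of the evolution operator -/

theorem aeval_conj_diagonal {ι : Type*} [Fintype ι] [DecidableEq ι] {V : Matrix ι ι ℂ}
    (hV : V ∈ Matrix.unitaryGroup ι ℂ) (d : ι → ℂ) (p : ℂ[X]) :
    aeval (V * Matrix.diagonal d * Vᴴ) p = V * Matrix.diagonal (fun i => p.eval (d i)) * Vᴴ := by
  have h1 : V * Vᴴ = 1 := Matrix.mem_unitaryGroup_iff.1 hV
  have h2 : Vᴴ * V = 1 := Matrix.mem_unitaryGroup_iff'.1 hV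
  induction p using Polynomial.induction_on' with
  | add p q hp hq =>
    rw [map_add, hp, hq, ← add_mul, ← mul_add, Matrix.diagonal_add]
    simp only [eval_add]
  | monomial k a =>
    rw [aeval_monomial]
    have hpow : (V * Matrix.diagonal d * Vᴴ) ^ k = V * Matrix.diagonal (d ^ k) * Vᴴ := by
      induction k with
      | zero => simp [h1]
      | succ k ih =>
        rw [pow_succ, ih]
        calc V * Matrix.diagonal (d ^ k) * Vᴴ * (V * Matrix.diagonal d * Vᴴ)
            = V * Matrix.diagonal (d ^ k) * (Vᴴ * V) * Matrix.diagonal d * Vᴴ := by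
              simp only [Matrix.mul_assoc]
          _ = _ := by
              rw [h2, Matrix.mul_one, Matrix.mul_assoc V, Matrix.diagonal_mul_diagonal]
              rfl
    rw [hpow, ← Algebra.smul_def, ← Matrix.smul_mul, ← Matrix.mul_smul, ← Matrix.diagonal_smul]
    congr 3
    ext i
    simp

section Instance

variable {n : ℕ} {η γ : ℝ} {H U UI : Matrix (Bits n) (Bits n) ℂ} {energy : ℝ} {ψ : Bits n → ℂ}

/-- Diagonalization of an instance of the estimation problem. -/
theorem IsEstimationInstance.exists_diagonalization
    (h : IsEstimationInstance η γ H U UI energy ψ) :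
    ∃ V ∈ Matrix.unitaryGroup (Bits n) ℂ, ∃ d : Bits n → ℝ, (∀ i, d i ∈ spectrum ℝ H) ∧
      H = V * Matrix.diagonal (fun i => (d i : ℂ)) * Vᴴ ∧
      U = V * Matrix.diagonal (fun i => Complex.exp (-(d i * Complex.I))) * Vᴴ := by
  refine ⟨_, h.hermitian.eigenvectorUnitary.2, h.hermitian.eigenvalues,
    h.hermitian.eigenvalues_mem_spectrum_real, ?_, ?_⟩
  · have := h.hermitian.spectral_theorem
    rwa [Unitary.conjStarAlgAut_apply] at this
  · have hH := h.hermitian.spectral_theorem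
    rw [Unitary.conjStarAlgAut_apply] at hH
    obtain ⟨V, hV⟩ : ∃ V, V = h.hermitian.eigenvectorUnitary := ⟨_, rfl⟩
    obtain ⟨d, hd⟩ : ∃ d, d = h.hermitian.eigenvalues := ⟨_, rfl⟩
    rw [← hV, ← hd] at hH ⊢
    have h1 : (V : Matrix (Bits n) (Bits n) ℂ) * (V : Matrix (Bits n) (Bits n) ℂ)ᴴ = 1 :=
      Matrix.mem_unitaryGroup_iff.1 V.2
    have hinv : (V : Matrix (Bits n) (Bits n) ℂ)⁻¹ = (V : Matrix (Bits n) (Bits n) ℂ)ᴴ :=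
      Matrix.inv_eq_right_inv h1
    have hunit : IsUnit (V : Matrix (Bits n) (Bits n) ℂ) :=
      IsUnit.of_mul_eq_one _ h1
    rw [Matrix.star_eq_conjTranspose, ← hinv] at hH
    rw [h.evolution, hH, ← hinv, ← Matrix.smul_mul, ← Matrix.mul_smul, Matrix.exp_conj _ _ hunit,
      ← Matrix.diagonal_smul, Matrix.exp_diagonal]
    congr 3
    ext i
    rw [Pi.coe_exp, ← Complex.exp_eq_exp_ℂ]
    simp [mul_comm]

theorem IsEstimationInstance.evolution_unitary (h : IsEstimationInstance η γ H U UI energy ψ) :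
    U ∈ Matrix.unitaryGroup (Bits n) ℂ := by
  obtain ⟨V, hV, d, -, -, rfl⟩ := h.exists_diagonalization
  refine mul_mem (mul_mem hV ?_) (Unitary.star_mem hV)
  rw [Matrix.mem_unitaryGroup_iff', Matrix.star_eq_conjTranspose, Matrix.diagonal_conjTranspose,
    Matrix.diagonal_mul_diagonal, ← Matrix.diagonal_one]
  congr 1
  ext i
  rw [Pi.star_apply, RCLike.star_def, ← Complex.exp_conj, ← Complex.exp_add]
  simp

theorem IsEstimationInstance.sum_norm_sq_prepared
    (h : IsEstimationInstance η γ H U UI energy ψ) :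
    ∑ x, ‖(UI *ᵥ zeroState n) x‖ ^ 2 = 1 := by
  rw [sum_norm_sq_unitary_mulVec h.prep_unitary, Finset.sum_eq_single 0]
  · simp [zeroState]
  · intro x _ hx
    simp [zeroState, Pi.single_eq_of_ne hx]
  · simp

/-- In an eigenbasis `p (U)` multiplies each coordinate by a value of `p` on the spectrum of `U`. -/
theorem IsEstimationInstance.sum_norm_sq_aeval_le
    (h : IsEstimationInstance η γ H U UI energy ψ) (p : ℂ[X]) (B : ℝ)
    (hB : ∀ l ∈ spectrum ℝ H, ‖p.eval (Complex.exp (-(l * Complex.I)))‖ ≤ B) :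
    ∑ x, ‖(aeval U p *ᵥ (UI *ᵥ zeroState n)) x‖ ^ 2 ≤ B ^ 2 := by
  obtain ⟨V, hV, d, hd, -, hU⟩ := h.exists_diagonalization
  have hV' : Vᴴ ∈ Matrix.unitaryGroup (Bits n) ℂ := Unitary.star_mem hV
  obtain ⟨φ, hφ⟩ : ∃ φ, φ = UI *ᵥ zeroState n := ⟨_, rfl⟩
  have h1 := h.sum_norm_sq_prepared
  rw [← hφ] at h1 ⊢
  rw [hU, aeval_conj_diagonal hV, ← Matrix.mulVec_mulVec, ← Matrix.mulVec_mulVec,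
    sum_norm_sq_unitary_mulVec hV, ← mul_one (B ^ 2), ← h1,
    ← sum_norm_sq_unitary_mulVec hV' φ,
    Finset.mul_sum]
  refine Finset.sum_le_sum fun i _ => ?_
  rw [Matrix.mulVec_diagonal, norm_mul, mul_pow]
  gcongr
  exact hB _ (hd i)

/-- By Cauchy–Schwarz, the norm of `p (U) φ` is at least the modulus of its component along the unit
vector `ψ`. -/
theorem IsEstimationInstance.le_sum_norm_sq_aeval
    (h : IsEstimationInstance η γ H U UI energy ψ) (hγ : 0 ≤ γ) (p : ℂ[X]) :
    ‖p.eval (Complex.exp (-(energy * Complex.I)))‖ ^ 2 * γ ^ 2 ≤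
      ∑ x, ‖(aeval U p *ᵥ (UI *ᵥ zeroState n)) x‖ ^ 2 := by
  obtain ⟨V, hV, d, hd, hH, hU⟩ := h.exists_diagonalization
  have hV2 : Vᴴ * V = 1 := Matrix.mem_unitaryGroup_iff'.1 hV
  have hV' : Vᴴ ∈ Matrix.unitaryGroup (Bits n) ℂ := Unitary.star_mem hV
  have hover := h.overlap
  obtain ⟨φ, hφ⟩ : ∃ φ, φ = UI *ᵥ zeroState n := ⟨_, rfl⟩
  rw [← hφ] at hover ⊢
  rw [← dotProduct_unitary_mulVec hV'] at hover
  have hψ : ∑ x, ‖(Vᴴ *ᵥ ψ) x‖ ^ 2 = 1 := by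
    rw [sum_norm_sq_unitary_mulVec hV', ← Complex.ofReal_inj, ofReal_sum_norm_sq, h.normalized,
      Complex.ofReal_one]
  have heig : ∀ i, (d i : ℂ) * (Vᴴ *ᵥ ψ) i = energy * (Vᴴ *ᵥ ψ) i := fun i => by
    have h1 := congrArg (fun v => (Vᴴ *ᵥ v) i) h.ground_state
    simp only [hH, ← Matrix.mulVec_mulVec, Matrix.mulVec_smul] at h1
    rw [Matrix.mulVec_mulVec _ Vᴴ V, hV2, Matrix.one_mulVec, Matrix.mulVec_diagonal] at h1
    exact h1
  rw [hU, aeval_conj_diagonal hV, ← Matrix.mulVec_mulVec, ← Matrix.mulVec_mulVec,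
    sum_norm_sq_unitary_mulVec hV]
  generalize Vᴴ *ᵥ ψ = ψ' at *
  generalize Vᴴ *ᵥ φ = φ' at *
  simp only [Matrix.mulVec_diagonal]
  obtain ⟨z, hz⟩ : ∃ z, z = p.eval (Complex.exp (-(energy * Complex.I))) := ⟨_, rfl⟩
  rw [← hz]
  -- `ψ'` is supported on coordinates whose eigenvalue is the ground energy, so a degenerate ground
  -- energy does no harm.
  have hp : ∀ i, p.eval (Complex.exp (-(d i * Complex.I))) * φ' i * conj (ψ' i) =
      z * (φ' i * conj (ψ' i)) := fun i => by
    by_cases h0 : ψ' i = 0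
    · simp [h0]
    · rw [mul_right_cancel₀ h0 (heig i), ← hz, mul_assoc]
  have hsum : ‖z‖ * γ ≤ ∑ i, ‖p.eval (Complex.exp (-(d i * Complex.I))) * φ' i‖ * ‖ψ' i‖ := by
    calc ‖z‖ * γ ≤ ‖z‖ * ‖star φ' ⬝ᵥ ψ'‖ := by gcongr
      _ = ‖∑ i, p.eval (Complex.exp (-(d i * Complex.I))) * φ' i * conj (ψ' i)‖ := by
          simp only [hp, ← Finset.mul_sum, norm_mul]
          congr 1
          rw [← RCLike.norm_conj, dotProduct, map_sum]
          simp
      _ ≤ _ := by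
          refine (norm_sum_le _ _).trans_eq (Finset.sum_congr rfl fun i _ => ?_)
          rw [norm_mul, RCLike.norm_conj]
  have hcs := Finset.sum_mul_sq_le_sq_mul_sq Finset.univ
    (fun i => ‖p.eval (Complex.exp (-(d i * Complex.I))) * φ' i‖) fun i => ‖ψ' i‖
  rw [hψ, mul_one] at hcs
  refine le_trans ?_ hcs
  rw [← mul_pow]
  gcongr

end Instance

/-! ### The majority polynomial -/

/-- The probability of at least `t` successes among `2 * t` trials of success probability `y`. -/
noncomputable def majority (t : ℕ) (y : ℝ) : ℝ :=
  ∑ k ∈ Finset.range (2 * t + 1) with t ≤ k, (2 * t).choose k * y ^ k * (1 - y) ^ (2 * t - k)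

theorem sum_binomial (m : ℕ) (y : ℝ) :
    ∑ k ∈ Finset.range (m + 1), (m.choose k : ℝ) * y ^ k * (1 - y) ^ (m - k) = 1 := by
  have h := add_pow y (1 - y) m
  rw [add_sub_cancel, one_pow] at h
  exact (Finset.sum_congr rfl fun k _ => by ring).trans h.symm

theorem binomial_term_nonneg {y : ℝ} (h0 : 0 ≤ y) (h1 : y ≤ 1) (m k : ℕ) :
    0 ≤ (m.choose k : ℝ) * y ^ k * (1 - y) ^ (m - k) := by
  have := sub_nonneg.2 h1
  positivity

theorem majority_nonneg {y : ℝ} (h0 : 0 ≤ y) (h1 : y ≤ 1) (t : ℕ) : 0 ≤ majority t y :=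
  Finset.sum_nonneg fun k _ => binomial_term_nonneg h0 h1 _ k

theorem majority_le_one {y : ℝ} (h0 : 0 ≤ y) (h1 : y ≤ 1) (t : ℕ) : majority t y ≤ 1 := by
  rw [← sum_binomial (2 * t) y]
  exact Finset.sum_le_sum_of_subset_of_nonneg (Finset.filter_subset _ _)
    fun k _ _ => binomial_term_nonneg h0 h1 _ k

/-- The binomial coefficients sum to `4 ^ t`. It is used with `x = y * (1 - y)`, which is at most `3
/ 16` once `y` is outside `(1 / 4, 3 / 4)`. -/
theorem sum_choose_mul_le (t : ℕ) (s : Finset ℕ) (hs : s ⊆ Finset.range (2 * t + 1)) {x : ℝ}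
    (h0 : 0 ≤ x) (h : x ≤ 3 / 16) :
    ∑ k ∈ s, ((2 * t).choose k : ℝ) * x ^ t ≤ (3 / 4) ^ t := by
  calc ∑ k ∈ s, ((2 * t).choose k : ℝ) * x ^ t
      ≤ ∑ k ∈ Finset.range (2 * t + 1), ((2 * t).choose k : ℝ) * x ^ t :=
        Finset.sum_le_sum_of_subset_of_nonneg hs fun k _ _ => by positivity
    _ = (4 * x) ^ t := by
        rw [← Finset.sum_mul, mul_pow]
        congr 1
        have := Nat.sum_range_choose (2 * t)
        rw [pow_mul] at this
        exact_mod_cast this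
    _ ≤ (3 / 4) ^ t := pow_le_pow_left₀ (by positivity) (by linarith) t

/-- Since `y ≤ 1 - y`, for `k ≥ t` the surplus factors `y` may be traded for `1 - y`, so every
weight is at most `(y * (1 - y)) ^ t`. The next bound treats the complementary tail in the same way.
-/
theorem majority_le {y : ℝ} (h0 : 0 ≤ y) (h : y ≤ 1 / 4) (t : ℕ) :
    majority t y ≤ (3 / 4) ^ t := by
  refine le_trans (Finset.sum_le_sum fun k hk => ?_)
    (sum_choose_mul_le t _ (Finset.filter_subset _ _) (x := y * (1 - y))
      (mul_nonneg h0 (by linarith)) (by nlinarith))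
  obtain ⟨hk1, hk2⟩ := Finset.mem_filter.1 hk
  obtain ⟨i, rfl⟩ := Nat.exists_eq_add_of_le hk2
  have hi : 2 * t - (t + i) = t - i := by omega
  have hit : t = (t - i) + i := by have := Finset.mem_range.1 hk1; omega
  have h1 : 0 ≤ 1 - y := by linarith
  rw [mul_assoc, hi]
  gcongr
  calc y ^ (t + i) * (1 - y) ^ (t - i) = y ^ t * (1 - y) ^ (t - i) * y ^ i := by ring
    _ ≤ y ^ t * (1 - y) ^ (t - i) * (1 - y) ^ i := by gcongr; linarith
    _ = (y * (1 - y)) ^ t := by rw [mul_assoc, ← pow_add, ← hit, mul_pow]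

theorem le_majority {y : ℝ} (h1 : y ≤ 1) (h : 3 / 4 ≤ y) (t : ℕ) :
    1 - (3 / 4) ^ t ≤ majority t y := by
  have hsum := sum_binomial (2 * t) y
  rw [← Finset.sum_filter_add_sum_filter_not _ (fun k => t ≤ k)] at hsum
  suffices ∑ k ∈ Finset.range (2 * t + 1) with ¬ t ≤ k,
      ((2 * t).choose k : ℝ) * y ^ k * (1 - y) ^ (2 * t - k) ≤ (3 / 4) ^ t by
    rw [majority]; linarith
  refine le_trans (Finset.sum_le_sum fun k hk => ?_)
    (sum_choose_mul_le t _ (Finset.filter_subset _ _) (x := y * (1 - y))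
      (mul_nonneg (by linarith) (by linarith)) (by nlinarith))
  obtain ⟨i, hi⟩ := Nat.exists_eq_add_of_lt (not_le.1 (Finset.mem_filter.1 hk).2)
  have hi' : 2 * t - k = t + (i + 1) := by omega
  have ht : t = k + (i + 1) := by omega
  have h0 : 0 ≤ 1 - y := by linarith
  rw [mul_assoc, hi']
  gcongr
  calc y ^ k * (1 - y) ^ (t + (i + 1)) = y ^ k * (1 - y) ^ (i + 1) * (1 - y) ^ t := by ring
    _ ≤ y ^ k * y ^ (i + 1) * (1 - y) ^ t := by
        have : 0 ≤ y := by linarith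
        gcongr; linarith
    _ = (y * (1 - y)) ^ t := by rw [← pow_add, ← ht, mul_pow]

/-! ### The Fejér kernel -/

/-- The Fejér kernel, normalized to the value `1` at `1`, as a function on the circle. -/
noncomputable def fejer (N : ℕ) (z : ℂ) : ℝ := ‖∑ j ∈ Finset.range N, z ^ j‖ ^ 2 / (N : ℝ) ^ 2

theorem fejer_nonneg (N : ℕ) (z : ℂ) : 0 ≤ fejer N z := by
  rw [fejer]; positivity

theorem fejer_le_one (N : ℕ) {z : ℂ} (hz : ‖z‖ = 1) : fejer N z ≤ 1 := by
  have h : ‖∑ j ∈ Finset.range N, z ^ j‖ ≤ N := by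
    refine (norm_sum_le _ _).trans ?_
    simp [hz]
  exact div_le_one_of_le₀ (pow_le_pow_left₀ (norm_nonneg _) h 2) (by positivity)

/-- The sum equals its conjugate times `z ^ (N - 1)`. Hence the Fejér kernel, which is no polynomial
in `z`, becomes one after multiplication by this phase. -/
theorem geom_sum_sq {z : ℂ} (hz : ‖z‖ = 1) (N : ℕ) :
    (∑ j ∈ Finset.range N, z ^ j) ^ 2 =
      ((‖∑ j ∈ Finset.range N, z ^ j‖ ^ 2 : ℝ) : ℂ) * z ^ (N - 1) := by
  have h : conj (∑ j ∈ Finset.range N, z ^ j) * z ^ (N - 1) = ∑ j ∈ Finset.range N, z ^ j := by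
    conv_lhs => rw [← Finset.sum_range_reflect (fun j => z ^ j), map_sum, Finset.sum_mul]
    refine Finset.sum_congr rfl fun j hj => ?_
    obtain ⟨a, ha⟩ : ∃ a, N - 1 = j + a := ⟨N - 1 - j, by have := Finset.mem_range.1 hj; omega⟩
    rw [ha, Nat.add_sub_cancel_left, pow_add, mul_left_comm, map_pow, ← mul_pow, mul_comm (conj z),
      mul_conj_of_norm_eq_one hz, one_pow, mul_one]
  rw [← Complex.normSq_eq_norm_sq, ← Complex.mul_conj, mul_assoc, h, sq]

/-- All `N` phases are at most `1 / 2`, so each term has real part at least `7 / 8`, and `(7 / 8) ^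
2 ≥ 3 / 4`. -/
theorem le_fejer {N : ℕ} (hN : 1 ≤ N) {x : ℝ} (hx : |x| ≤ 1 / (2 * N)) :
    3 / 4 ≤ fejer N (Complex.exp (x * Complex.I)) := by
  have hN' : (0 : ℝ) < N := by exact_mod_cast hN
  have hre : (7 / 8 : ℝ) * N ≤ ‖∑ j ∈ Finset.range N, Complex.exp (x * Complex.I) ^ j‖ := by
    refine le_trans ?_ (Complex.re_le_norm _)
    rw [Complex.re_sum]
    have : ∀ j ∈ Finset.range N, (7 / 8 : ℝ) ≤ (Complex.exp (x * Complex.I) ^ j).re := by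
      intro j hj
      rw [← Complex.exp_nat_mul, ← mul_assoc]
      have hc : (j : ℂ) * x = ((j * x : ℝ) : ℂ) := by push_cast; rfl
      rw [hc, Complex.exp_ofReal_mul_I_re]
      have hj' : (j : ℝ) ≤ N := by exact_mod_cast (Finset.mem_range.1 hj).le
      have habs : |j * x| ≤ 1 / 2 := by
        rw [abs_mul, Nat.abs_cast]
        calc (j : ℝ) * |x| ≤ N * (1 / (2 * N)) := by gcongr
          _ = 1 / 2 := by field_simp
      have h2 := Real.one_sub_sq_div_two_le_cos (x := j * x)
      have h3 : (j * x) ^ 2 ≤ (1 / 2) ^ 2 := sq_le_sq' (abs_le.1 habs).1 (abs_le.1 habs).2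
      linarith
    have h := Finset.sum_le_sum this
    rw [Finset.sum_const, Finset.card_range, nsmul_eq_mul] at h
    linarith
  rw [fejer, le_div_iff₀ (by positivity)]
  nlinarith

/-- The geometric sum times `z - 1` has modulus at most `2`, while Jordan's inequality, valid up to
`x = π`, gives `|z - 1| ≥ 2 * x / π ≥ 4 / N`. So the sum is at most `N / 2`. -/
theorem fejer_le {N : ℕ} (hN : 1 ≤ N) {x : ℝ} (hx : 2 * Real.pi / N ≤ x) (hx' : x ≤ Real.pi) :
    fejer N (Complex.exp (-(x * Complex.I))) ≤ 1 / 4 := by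
  have hN' : (0 : ℝ) < N := by exact_mod_cast hN
  have hpi := Real.pi_pos
  have hx0 : 0 < x := lt_of_lt_of_le (by positivity) hx
  have hz : ‖Complex.exp (-(x * Complex.I))‖ = 1 := by
    have := Complex.norm_exp_ofReal_mul_I (-x)
    rwa [Complex.ofReal_neg, neg_mul] at this
  have hsub : 2 / Real.pi * x ≤ ‖Complex.exp (-(x * Complex.I)) - 1‖ := by
    have h := Complex.norm_exp_I_mul_ofReal_sub_one (-x)
    rw [Complex.ofReal_neg, mul_neg, mul_comm Complex.I] at h
    rw [h]
    refine le_trans ?_ (neg_le_abs _)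
    have := Real.mul_le_sin (x := x / 2) (by linarith) (by linarith)
    rw [neg_div, Real.sin_neg]
    linarith
  have hgeom := geom_sum_mul (Complex.exp (-(x * Complex.I))) N
  have hle : ‖∑ j ∈ Finset.range N, Complex.exp (-(x * Complex.I)) ^ j‖ *
      ‖Complex.exp (-(x * Complex.I)) - 1‖ ≤ 2 := by
    rw [← norm_mul, hgeom]
    refine (norm_sub_le _ _).trans ?_
    rw [norm_pow, hz, norm_one, one_pow]
    norm_num
  generalize ‖Complex.exp (-(x * Complex.I)) - 1‖ = a at *
  rw [fejer]
  generalize hg : ‖∑ j ∈ Finset.range N, Complex.exp (-(x * Complex.I)) ^ j‖ = g at *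
  have hg0 : 0 ≤ g := hg ▸ norm_nonneg _
  have h4 : 4 / N ≤ a := by
    refine le_trans ?_ hsub
    calc (4 : ℝ) / N = 2 / Real.pi * (2 * Real.pi / N) := by field_simp; norm_num
      _ ≤ _ := by gcongr
  have h5 : g * (4 / N) ≤ 2 := (mul_le_mul_of_nonneg_left h4 hg0).trans hle
  have h6 : g ≤ N / 2 := by
    rw [mul_div_assoc', div_le_iff₀ hN'] at h5
    linarith
  rw [div_le_iff₀ (by positivity)]
  nlinarith

/-! ### The filter polynomial -/

/-- A polynomial whose modulus on the circle is half the majority of the Fejér kernel. -/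
noncomputable def filterPoly (N t : ℕ) : ℂ[X] :=
  C (1 / 2) * ∑ k ∈ Finset.range (2 * t + 1) with t ≤ k, C ((2 * t).choose k : ℂ) *
    (C ((N : ℂ) ^ 2)⁻¹ * (∑ j ∈ Finset.range N, X ^ j) ^ 2) ^ k *
    (X ^ (N - 1) - C ((N : ℂ) ^ 2)⁻¹ * (∑ j ∈ Finset.range N, X ^ j) ^ 2) ^ (2 * t - k)

theorem natDegree_filterPoly_le (N t : ℕ) : (filterPoly N t).natDegree ≤ 4 * t * (N - 1) := by
  have hG : (∑ j ∈ Finset.range N, (X : ℂ[X]) ^ j).natDegree ≤ N - 1 :=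
    natDegree_sum_le_of_forall_le _ _ fun j hj => by
      have := Finset.mem_range.1 hj
      rw [natDegree_X_pow]; omega
  have hY : (C ((N : ℂ) ^ 2)⁻¹ * (∑ j ∈ Finset.range N, (X : ℂ[X]) ^ j) ^ 2).natDegree ≤
      2 * (N - 1) :=
    (natDegree_C_mul_le _ _).trans (natDegree_pow_le_of_le 2 hG)
  refine (natDegree_C_mul_le _ _).trans (natDegree_sum_le_of_forall_le _ _ fun k hk => ?_)
  have hk' : k ≤ 2 * t := by have := Finset.mem_range.1 (Finset.mem_filter.1 hk).1; omega
  rw [mul_assoc]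
  refine (natDegree_C_mul_le _ _).trans ((natDegree_mul_le_of_le (natDegree_pow_le_of_le k hY)
    (natDegree_pow_le_of_le (2 * t - k) ((natDegree_sub_le _ _).trans
      (max_le (c := 2 * (N - 1)) ?_ hY)))).trans_eq ?_)
  · rw [natDegree_X_pow]; omega
  · rw [← add_mul, Nat.add_sub_cancel' hk']; ring

/-- The two bases in `filterPoly` are `F` and `1 - F` times the common phase `z ^ (N - 1)`, where
`F` is the Fejér kernel. Their exponents always add up to `2 * t`, so all summands share one phase.
-/
theorem norm_eval_filterPoly (N t : ℕ) {z : ℂ} (hz : ‖z‖ = 1) :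
    ‖(filterPoly N t).eval z‖ = majority t (fejer N z) / 2 := by
  have hY : ((N : ℂ) ^ 2)⁻¹ * (∑ j ∈ Finset.range N, z ^ j) ^ 2 = fejer N z * z ^ (N - 1) := by
    rw [geom_sum_sq hz, fejer]
    push_cast
    ring
  have h : (filterPoly N t).eval z =
      ((majority t (fejer N z) / 2 : ℝ) : ℂ) * z ^ ((N - 1) * (2 * t)) := by
    simp only [filterPoly, eval_mul, eval_C, eval_finsetSum, eval_pow, eval_sub, eval_X, hY,
      majority]
    push_cast
    rw [div_mul_eq_mul_div, one_mul, div_mul_eq_mul_div, Finset.sum_mul]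
    congr 1
    refine Finset.sum_congr rfl fun k hk => ?_
    have hk' : k + (2 * t - k) = 2 * t := by
      have := Finset.mem_range.1 (Finset.mem_filter.1 hk).1; omega
    rw [← one_sub_mul, mul_pow, mul_pow, pow_mul]
    conv_rhs => rw [← hk', pow_add]
    rw [hk']
    ring
  rw [h, norm_mul, norm_pow, hz, one_pow, mul_one, Complex.norm_real, Real.norm_eq_abs,
    abs_of_nonneg]
  exact div_nonneg (majority_nonneg (fejer_nonneg N z) (fejer_le_one N hz) t) zero_le_two

/-- Filtering of the prepared state around the energy `L`, with resolution `1 / N` and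
contrast `(3 / 4) ^ t`. -/
theorem exists_filter_circuit (L : ℝ) (N t : ℕ) (hN : 1 ≤ N) :
    ∃ c : Circuit, c.countP Gate.isEvolution = 4 * t * (N - 1) ∧ c.countP Gate.isPrep = 1 ∧
      c.countP Gate.isOneQubit = 4 * t * (N - 1) + 1 ∧
      ∀ (n : ℕ) (η γ : ℝ) (H U UI : Matrix (Bits n) (Bits n) ℂ) (energy : ℝ) (ψ : Bits n → ℂ),
        0 ≤ η → 0 ≤ γ → IsEstimationInstance η γ H U UI energy ψ →
        (|energy - L| ≤ 1 / (2 * N) →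
          ((1 - (3 / 4) ^ t) / 2) ^ 2 * γ ^ 2 ≤ c.outcomeProb U UI 0) ∧
        (0 ≤ L → 2 * Real.pi / N ≤ energy - L →
          c.outcomeProb U UI 0 ≤ ((3 / 4) ^ t / 2) ^ 2) := by
  obtain ⟨ω, hω⟩ : ∃ ω, ω = Complex.exp (L * Complex.I) := ⟨_, rfl⟩
  have hω1 : ‖ω‖ = 1 := hω ▸ Complex.norm_exp_ofReal_mul_I L
  -- Rotating the argument moves the peak of the filter from energy `0` to energy `L`.
  obtain ⟨p, hp⟩ : ∃ p, p = (filterPoly N t).comp (C ω * X) := ⟨_, rfl⟩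
  have heval : ∀ z, p.eval z = (filterPoly N t).eval (ω * z) := fun z => by
    rw [hp, eval_comp, eval_mul, eval_C, eval_X]
  have hshift : ∀ l : ℝ, ω * Complex.exp (-(l * Complex.I)) =
      Complex.exp (-(((l - L : ℝ) : ℂ) * Complex.I)) := fun l => by
    rw [hω, ← Complex.exp_add]
    push_cast
    ring_nf
  have hnorm : ∀ l : ℝ, ‖Complex.exp (-((l : ℂ) * Complex.I))‖ = 1 := fun l => by
    have := Complex.norm_exp_ofReal_mul_I (-l)
    rwa [Complex.ofReal_neg, neg_mul] at this
  obtain ⟨c, hc1, hc2, hc3, hc⟩ := exists_circuit (4 * t * (N - 1)) p (by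
      rw [hp]
      refine natDegree_comp_le.trans ?_
      refine (Nat.mul_le_mul (natDegree_filterPoly_le N t)
        ((natDegree_C_mul_le ω X).trans natDegree_X_le)).trans_eq (mul_one _))
    fun z hz => by
      have hz' : ‖ω * z‖ = 1 := by rw [norm_mul, hω1, hz, one_mul]
      rw [heval, norm_eval_filterPoly N t hz']
      linarith [majority_le_one (fejer_nonneg N (ω * z)) (fejer_le_one N hz') t]
  refine ⟨c, hc1, hc2, hc3, fun n η γ H U UI energy ψ hη hγ h => ⟨fun he => ?_, fun hL he => ?_⟩⟩
  · rw [hc]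
    refine le_trans ?_ (h.le_sum_norm_sq_aeval hγ p)
    have h1 : ((3 : ℝ) / 4) ^ t ≤ 1 := pow_le_one₀ (by norm_num) (by norm_num)
    rw [heval, hshift, norm_eval_filterPoly N t (hnorm _)]
    have h2 := le_fejer hN (x := -(energy - L)) (by rwa [abs_neg])
    rw [Complex.ofReal_neg, neg_mul] at h2
    have h3 := le_majority (fejer_le_one N (hnorm _)) h2 t
    gcongr
  · rw [hc]
    refine h.sum_norm_sq_aeval_le p _ fun l hl => ?_
    -- Every eigenvalue `l` is at least the ground energy, and `l - L ≤ π` because `L ≥ 0`: no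
    -- eigenvalue wraps around the circle towards the peak.
    have h1 := h.ground_energy.2 hl
    have h2 := (h.spectrum_subset hl).2
    rw [heval, hshift, norm_eval_filterPoly N t (hnorm _)]
    have := majority_le (fejer_nonneg N _)
      (fejer_le hN (x := l - L) (by linarith) (by linarith)) t
    linarith

/-! ### Counting outcomes -/

/-- Run `c` repeatedly, `M` times; continue with `yes` if the outcome `0` occurs at least `s` times,
and with `no` otherwise. -/
def countTest (c : Circuit) (yes no : Algorithm) : ℕ → ℕ → Algorithm
  | 0, 0 => yes
  | 0, _ + 1 => no
  -- Truncated subtraction keeps the count of missing successes at zero once it is reached.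
  | M + 1, s => .run c ![countTest c yes no M (s - 1), countTest c yes no M s]

theorem total_countTest_le (kind : Gate → Bool) (c : Circuit) (yes no : Algorithm) (M s : ℕ) :
    (countTest c yes no M s).total kind ≤
      M * c.countP kind + max (yes.total kind) (no.total kind) := by
  induction M generalizing s with
  | zero => cases s <;> simp [countTest]
  | succ M ih =>
    have h1 := ih (s - 1)
    have h2 := ih s
    simp only [countTest, Algorithm.total, Matrix.cons_val_zero, Matrix.cons_val_one]
    rw [Nat.succ_mul]
    have := max_le h1 h2
    omega

theorem maxPerRun_countTest_le (kind : Gate → Bool) (c : Circuit) (yes no : Algorithm)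
    (M s : ℕ) : (countTest c yes no M s).maxPerRun kind ≤
      max (c.countP kind) (max (yes.maxPerRun kind) (no.maxPerRun kind)) := by
  induction M generalizing s with
  | zero => cases s <;> simp [countTest]
  | succ M ih =>
    simp only [countTest, Algorithm.maxPerRun, Matrix.cons_val_zero, Matrix.cons_val_one]
    exact max_le (le_max_left _ _) (max_le (ih _) (ih _))

section Probability

variable {n : ℕ} {U UI : Matrix (Bits n) (Bits n) ℂ} (S : Set ℝ) (c : Circuit)
  (yes no : Algorithm)

theorem prob_countTest_succ (hU : U ∈ Matrix.unitaryGroup (Bits n) ℂ)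
    (hUI : UI ∈ Matrix.unitaryGroup (Bits n) ℂ) (M s : ℕ) :
    (countTest c yes no (M + 1) s).prob U UI S =
      c.outcomeProb U UI 0 * (countTest c yes no M (s - 1)).prob U UI S +
        (1 - c.outcomeProb U UI 0) * (countTest c yes no M s).prob U UI S := by
  rw [countTest, Algorithm.prob, Fin.sum_univ_two, ← outcomeProb_add hU hUI c, add_sub_cancel_left]
  rfl

theorem outcomeProb_le_one (hU : U ∈ Matrix.unitaryGroup (Bits n) ℂ)
    (hUI : UI ∈ Matrix.unitaryGroup (Bits n) ℂ) : c.outcomeProb U UI 0 ≤ 1 := by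
  linarith [outcomeProb_add hU hUI c, outcomeProb_nonneg U UI c 1]

/-- This serves the middle of the interval, where both continuations are good and nothing is known
about the outcome probability. -/
theorem min_le_prob_countTest (hU : U ∈ Matrix.unitaryGroup (Bits n) ℂ)
    (hUI : UI ∈ Matrix.unitaryGroup (Bits n) ℂ) {q : ℝ} (hy : q ≤ yes.prob U UI S)
    (hn : q ≤ no.prob U UI S) (M s : ℕ) : q ≤ (countTest c yes no M s).prob U UI S := by
  induction M generalizing s with
  | zero => cases s <;> simpa [countTest]
  | succ M ih =>
    rw [prob_countTest_succ S c yes no hU hUI]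
    have h0 := outcomeProb_nonneg U UI c 0
    have h1 := outcomeProb_le_one c hU hUI
    nlinarith [mul_le_mul_of_nonneg_left (ih (s - 1)) h0,
      mul_le_mul_of_nonneg_left (ih s) (sub_nonneg.2 h1)]

/-- A Chernoff bound for the lower tail. -/
theorem prob_countTest_yes (hU : U ∈ Matrix.unitaryGroup (Bits n) ℂ)
    (hUI : UI ∈ Matrix.unitaryGroup (Bits n) ℂ) (M s : ℕ) :
    yes.prob U UI S - 2 ^ s * (1 - c.outcomeProb U UI 0 / 2) ^ M ≤
      (countTest c yes no M s).prob U UI S := by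
  have h0 := outcomeProb_nonneg U UI c 0
  have h1 := outcomeProb_le_one c hU hUI
  have hzero : ∀ M, (countTest c yes no M 0).prob U UI S = yes.prob U UI S := fun M => by
    induction M with
    | zero => rfl
    | succ M ih => rw [prob_countTest_succ S c yes no hU hUI, Nat.zero_sub, ih]; ring
  have hpow : ∀ M, 0 ≤ (1 - c.outcomeProb U UI 0 / 2) ^ M := fun M => pow_nonneg (by linarith) M
  -- The error term is Markov's bound for `2 ^ (-X)`, with `X` the number of outcomes `0`: each run
  -- contributes the mean `1 - p / 2`, where `p` is the probability of `0`. The upper tail uses `2 ^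
  -- X` and the mean `1 + p`.
  induction M generalizing s with
  | zero =>
    rcases s with _ | s
    · simp [hzero]
    · have h2 := prob_le_one hU hUI S yes
      have h3 := prob_nonneg U UI S no
      have h4 : (1 : ℝ) ≤ 2 ^ (s + 1) := one_le_pow₀ (by norm_num)
      simp only [countTest, pow_zero, mul_one]
      linarith
  | succ M ih =>
    rcases s with _ | s
    · rw [hzero]; linarith [hpow (M + 1)]
    · rw [prob_countTest_succ S c yes no hU hUI, Nat.add_sub_cancel]
      have h2 := mul_le_mul_of_nonneg_left (ih s) h0
      have h3 := mul_le_mul_of_nonneg_left (ih (s + 1)) (sub_nonneg.2 h1)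
      refine le_trans (le_of_eq ?_) (add_le_add h2 h3)
      ring

/-- A Chernoff bound for the upper tail. -/
theorem prob_countTest_no (hU : U ∈ Matrix.unitaryGroup (Bits n) ℂ)
    (hUI : UI ∈ Matrix.unitaryGroup (Bits n) ℂ) (M s : ℕ) :
    no.prob U UI S - (2 ^ s)⁻¹ * (1 + c.outcomeProb U UI 0) ^ M ≤
      (countTest c yes no M s).prob U UI S := by
  have h0 := outcomeProb_nonneg U UI c 0
  have h1 := outcomeProb_le_one c hU hUI
  have hzero : ∀ M, no.prob U UI S - (2 ^ 0)⁻¹ * (1 + c.outcomeProb U UI 0) ^ M ≤ 0 := fun M => by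
    have h2 := prob_le_one hU hUI S no
    have h3 : 1 ≤ (1 + c.outcomeProb U UI 0) ^ M := one_le_pow₀ (by linarith)
    rw [pow_zero, inv_one, one_mul]
    linarith
  induction M generalizing s with
  | zero =>
    rcases s with _ | s
    · exact (hzero 0).trans (prob_nonneg _ _ _ _)
    · simp [countTest]
  | succ M ih =>
    rcases s with _ | s
    · exact (hzero _).trans (prob_nonneg _ _ _ _)
    · rw [prob_countTest_succ S c yes no hU hUI, Nat.add_sub_cancel]
      have h2 := mul_le_mul_of_nonneg_left (ih s) h0
      have h3 := mul_le_mul_of_nonneg_left (ih (s + 1)) (sub_nonneg.2 h1)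
      refine le_trans (le_of_eq ?_) (add_le_add h2 h3)
      have h4 : ((2 : ℝ) ^ s)⁻¹ = 2 * (2 ^ (s + 1))⁻¹ := by
        rw [pow_succ, mul_inv]; ring
      rw [h4]
      ring

end Probability

/-! ### Fuzzy bisection -/

/-- Search for the ground-state energy in `[L, L + W]`. In each of the `k` steps, the outcomes `0`
of the circuit `circ L W` are counted, and one of the two ends of the interval is cut off. -/
noncomputable def search (circ : ℝ → ℝ → Circuit) (M s : ℕ) : ℕ → ℝ → ℝ → Algorithm
  | 0, L, _ => .output L
  | k + 1, L, W => countTest (circ L W) (search circ M s k L (19 / 20 * W))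
      (search circ M s k (L + W / 20) (19 / 20 * W)) M s

/-- Only the `k` widths that are tested have to be at least `w`; the final width is not constrained.
-/
theorem total_search_le (kind : Gate → Bool) (circ : ℝ → ℝ → Circuit) (M s K : ℕ) {w : ℝ}
    (hK : ∀ L W, w ≤ W → W ≤ Real.pi → (circ L W).countP kind ≤ K) (k : ℕ) (L W : ℝ)
    (hW : ∀ j < k, w ≤ (19 / 20) ^ j * W) (hW0 : 0 ≤ W) (hWpi : W ≤ Real.pi) :
    (search circ M s k L W).total kind ≤ k * (M * K) := by
  induction k generalizing L W with
  | zero => simp [search, Algorithm.total]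
  | succ k ih =>
    have hW' : ∀ j < k, w ≤ (19 / 20) ^ j * (19 / 20 * W) := fun j hj => by
      rw [← mul_assoc, ← pow_succ]
      exact hW (j + 1) (by omega)
    have h0 := hW 0 (by omega)
    rw [pow_zero, one_mul] at h0
    have h1 := ih L _ hW' (by linarith) (by linarith)
    have h2 := ih (L + W / 20) _ hW' (by linarith) (by linarith)
    refine (total_countTest_le _ _ _ _ _ _).trans ?_
    have h3 := Nat.mul_le_mul_left M (hK L W h0 hWpi)
    rw [Nat.succ_mul]
    have := max_le h1 h2
    omega

theorem maxPerRun_search_le (kind : Gate → Bool) (circ : ℝ → ℝ → Circuit) (M s K : ℕ) {w : ℝ}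
    (hK : ∀ L W, w ≤ W → W ≤ Real.pi → (circ L W).countP kind ≤ K) (k : ℕ) (L W : ℝ)
    (hW : ∀ j < k, w ≤ (19 / 20) ^ j * W) (hW0 : 0 ≤ W) (hWpi : W ≤ Real.pi) :
    (search circ M s k L W).maxPerRun kind ≤ K := by
  induction k generalizing L W with
  | zero => simp [search, Algorithm.maxPerRun]
  | succ k ih =>
    have hW' : ∀ j < k, w ≤ (19 / 20) ^ j * (19 / 20 * W) := fun j hj => by
      rw [← mul_assoc, ← pow_succ]
      exact hW (j + 1) (by omega)
    have h0 := hW 0 (by omega)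
    rw [pow_zero, one_mul] at h0
    exact (maxPerRun_countTest_le _ _ _ _ _ _).trans (max_le (hK L W h0 hWpi)
      (max_le (ih L _ hW' (by linarith) (by linarith))
        (ih (L + W / 20) _ hW' (by linarith) (by linarith))))

/-- A union bound over the steps: a step can fail, with probability at most `δ`, only if the energy
lies in an outer twentieth of the interval. The final output `L` is off by at most the final width.
-/
theorem le_prob_search {n : ℕ} {U UI : Matrix (Bits n) (Bits n) ℂ}
    (hU : U ∈ Matrix.unitaryGroup (Bits n) ℂ) (hUI : UI ∈ Matrix.unitaryGroup (Bits n) ℂ)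
    (circ : ℝ → ℝ → Circuit) (M s : ℕ) {energy p₀ p₁ δ : ℝ} (hδ : 0 ≤ δ)
    (hyes : 2 ^ s * (1 - p₁ / 2) ^ M ≤ δ) (hno : (2 ^ s)⁻¹ * (1 + p₀) ^ M ≤ δ)
    (hcirc : ∀ L W, 0 ≤ L → 0 < W → W ≤ Real.pi → L ≤ energy → energy ≤ L + W →
      (energy ≤ L + W / 20 → p₁ ≤ (circ L W).outcomeProb U UI 0) ∧
      (L + 19 / 20 * W ≤ energy → (circ L W).outcomeProb U UI 0 ≤ p₀))
    (k : ℕ) (L W : ℝ) (hL : 0 ≤ L) (hW0 : 0 < W) (hWpi : W ≤ Real.pi) (hLe : L ≤ energy)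
    (heW : energy ≤ L + W) :
    1 - k * δ ≤ (search circ M s k L W).prob U UI
      {a : ℝ | |a - energy| ≤ (19 / 20) ^ k * W} := by
  induction k generalizing L W with
  | zero =>
    have h : L ∈ {a : ℝ | |a - energy| ≤ (19 / 20) ^ 0 * W} := by
      rw [Set.mem_ofPred_eq, abs_le]
      constructor <;> linarith
    rw [search, Algorithm.prob, Set.indicator_of_mem h]
    simp
  | succ k ih =>
    have hset : (19 / 20 : ℝ) ^ (k + 1) * W = (19 / 20) ^ k * (19 / 20 * W) := by ring
    rw [hset, search]
    have hcirc' := hcirc L W hL hW0 hWpi hLe heW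
    have hy : energy ≤ L + 19 / 20 * W → 1 - k * δ ≤
        (search circ M s k L (19 / 20 * W)).prob U UI
          {a : ℝ | |a - energy| ≤ (19 / 20) ^ k * (19 / 20 * W)} := fun h =>
      ih L _ hL (by linarith) (by linarith) hLe h
    have hn : L + W / 20 ≤ energy → 1 - k * δ ≤
        (search circ M s k (L + W / 20) (19 / 20 * W)).prob U UI
          {a : ℝ | |a - energy| ≤ (19 / 20) ^ k * (19 / 20 * W)} := fun h =>
      ih _ _ (by linarith) (by linarith) (by linarith) h (by linarith)
    generalize {a : ℝ | |a - energy| ≤ (19 / 20) ^ k * (19 / 20 * W)} = S at *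
    generalize search circ M s k L (19 / 20 * W) = yes at *
    generalize search circ M s k (L + W / 20) (19 / 20 * W) = no at *
    push_cast
    have h0 := outcomeProb_nonneg U UI (circ L W) 0
    have h1 := outcomeProb_le_one (circ L W) hU hUI
    by_cases he1 : energy ≤ L + W / 20
    · have h2 := prob_countTest_yes S (circ L W) yes no hU hUI M s
      have h3 : 2 ^ s * (1 - (circ L W).outcomeProb U UI 0 / 2) ^ M ≤
          2 ^ s * (1 - p₁ / 2) ^ M := by
        have := hcirc'.1 he1
        gcongr
        linarith
      linarith [hy (by linarith)]
    · by_cases he2 : L + 19 / 20 * W ≤ energy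
      · have h2 := prob_countTest_no S (circ L W) yes no hU hUI M s
        have h3 : (2 ^ s)⁻¹ * (1 + (circ L W).outcomeProb U UI 0) ^ M ≤
            (2 ^ s)⁻¹ * (1 + p₀) ^ M := by
          have := hcirc'.2 he2
          gcongr
        linarith [hn (by linarith)]
      · have := min_le_prob_countTest S (circ L W) yes no hU hUI
          (hy (by linarith)) (hn (by linarith)) M s
        linarith

/-! ### The test circuit of one bisection step -/

/-- The resolution must satisfy `2 * π / N ≤ 19 / 20 * W` and `W / 20 ≤ 1 / (2 * N)`, that is, `40 *
π / (19 * W) ≤ N ≤ 10 / W`. Rounding the lower bound up stays below the upper one because `W ≤ π`.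
-/
theorem exists_bisection_circuit (t : ℕ) {γ : ℝ} (hγ : 0 < γ) (hγ1 : γ ≤ 1)
    (ht : (3 / 4 : ℝ) ^ t ≤ γ / 8) :
    ∃ circ : ℝ → ℝ → Circuit, ∀ L W, 0 < W → W ≤ Real.pi →
      ((circ L W).countP Gate.isEvolution : ℝ) ≤ 40 * t / W ∧
      (circ L W).countP Gate.isPrep ≤ 1 ∧
      ((circ L W).countP Gate.isOneQubit : ℝ) ≤ 40 * t / W ∧
      ∀ (n : ℕ) (η : ℝ) (H U UI : Matrix (Bits n) (Bits n) ℂ) (energy : ℝ) (ψ : Bits n → ℂ),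
        0 ≤ η → IsEstimationInstance η γ H U UI energy ψ → 0 ≤ L → L ≤ energy →
        (energy ≤ L + W / 20 → γ ^ 2 / 16 ≤ (circ L W).outcomeProb U UI 0) ∧
        (L + 19 / 20 * W ≤ energy → (circ L W).outcomeProb U UI 0 ≤ γ ^ 2 / 256) := by
  -- Needed to absorb the one extra rotation: `4 * t * (N - 1) + 1 ≤ 4 * t * N`.
  have ht1 : 1 ≤ t := by
    rcases t with _ | t
    · norm_num at ht; linarith
    · omega
  have hmain : ∀ L W : ℝ, ∃ c : Circuit, 0 < W → W ≤ Real.pi →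
      (c.countP Gate.isEvolution : ℝ) ≤ 40 * t / W ∧
      c.countP Gate.isPrep ≤ 1 ∧
      (c.countP Gate.isOneQubit : ℝ) ≤ 40 * t / W ∧
      ∀ (n : ℕ) (η : ℝ) (H U UI : Matrix (Bits n) (Bits n) ℂ) (energy : ℝ) (ψ : Bits n → ℂ),
        0 ≤ η → IsEstimationInstance η γ H U UI energy ψ → 0 ≤ L → L ≤ energy →
        (energy ≤ L + W / 20 → γ ^ 2 / 16 ≤ c.outcomeProb U UI 0) ∧
        (L + 19 / 20 * W ≤ energy → c.outcomeProb U UI 0 ≤ γ ^ 2 / 256) := fun L W => by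
    by_cases hW : 0 < W ∧ W ≤ Real.pi
    swap
    · exact ⟨[], fun h1 h2 => absurd ⟨h1, h2⟩ hW⟩
    obtain ⟨hW, hWpi⟩ := hW
    have hpi := Real.pi_pos
    have hpi' := Real.pi_lt_d2
    obtain ⟨N, hN⟩ : ∃ N, N = ⌈40 * Real.pi / (19 * W)⌉₊ := ⟨_, rfl⟩
    have hN1 : 1 ≤ N := by
      rw [hN]; exact Nat.ceil_pos.2 (by positivity)
    have hN0 : (0 : ℝ) < N := by exact_mod_cast hN1
    have hNlow : 40 * Real.pi / (19 * W) ≤ N := hN ▸ Nat.le_ceil _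
    have hNup : N ≤ 10 / W := by
      have h := (Nat.ceil_lt_add_one (show 0 ≤ 40 * Real.pi / (19 * W) by positivity)).le
      rw [← hN] at h
      refine h.trans ?_
      rw [div_add_one (by positivity), div_le_div_iff₀ (by positivity) hW]
      nlinarith
    obtain ⟨c, hc1, hc2, hc3, hc⟩ := exists_filter_circuit L N t hN1
    have hcost : ((4 * t * (N - 1) + 1 : ℕ) : ℝ) ≤ 40 * t / W := by
      have h1 : 4 * t * (N - 1) + 1 ≤ 4 * t * N := by
        obtain ⟨m, rfl⟩ := Nat.exists_eq_add_of_le hN1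
        rw [Nat.add_sub_cancel_left, mul_add]
        omega
      calc ((4 * t * (N - 1) + 1 : ℕ) : ℝ) ≤ ((4 * t * N : ℕ) : ℝ) := by exact_mod_cast h1
        _ = 4 * t * N := by push_cast; rfl
        _ ≤ 4 * t * (10 / W) := by gcongr
        _ = 40 * t / W := by ring
    refine ⟨c, fun _ _ => ⟨?_, hc2.le, ?_, ?_⟩⟩
    · refine le_trans ?_ hcost
      rw [hc1]; exact_mod_cast Nat.le_succ _
    · rw [hc3]; exact hcost
    · intro n η H U UI energy ψ hη h hL hLe
      obtain ⟨h1, h2⟩ := hc n η γ H U UI energy ψ hη hγ.le h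
      refine ⟨fun he => ?_, fun he => ?_⟩
      · refine le_trans ?_ (h1 ?_)
        · have h3 : (1 / 4 : ℝ) ≤ (1 - (3 / 4) ^ t) / 2 := by linarith
          have h4 := pow_le_pow_left₀ (by norm_num) h3 2
          nlinarith [sq_nonneg γ]
        · rw [abs_of_nonneg (by linarith)]
          have h5 : W / 20 ≤ 1 / (2 * N) := by
            rw [le_div_iff₀ hW] at hNup
            rw [div_le_div_iff₀ (by norm_num) (by positivity)]
            linarith
          linarith
      · refine (h2 hL ?_).trans ?_
        · refine le_trans ?_ (show 19 / 20 * W ≤ energy - L by linarith)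
          rw [div_le_iff₀ (by positivity)] at hNlow
          rw [div_le_iff₀ hN0]
          linarith
        · have h3 : (3 / 4 : ℝ) ^ t / 2 ≤ γ / 16 := by linarith
          refine (pow_le_pow_left₀ (by positivity) h3 2).trans_eq ?_
          ring
  choose circ hcirc using hmain
  exact ⟨circ, hcirc⟩

/-! ### Parameters -/

theorem three_quarters_pow_le {n : ℕ} {x : ℝ} (hx : 0 < x) (h : 4 * Real.log x ≤ n) :
    (3 / 4 : ℝ) ^ n ≤ x⁻¹ := by
  have h1 : (3 / 4 : ℝ) ≤ Real.exp (-(1 / 4)) := by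
    have := Real.add_one_le_exp (-(1 / 4) : ℝ)
    linarith
  calc (3 / 4 : ℝ) ^ n ≤ Real.exp (-(1 / 4)) ^ n := pow_le_pow_left₀ (by norm_num) h1 n
    _ = Real.exp (n * -(1 / 4)) := (Real.exp_nat_mul _ _).symm
    _ ≤ Real.exp (-Real.log x) := Real.exp_le_exp.2 (by linarith)
    _ = x⁻¹ := by rw [Real.exp_neg, Real.exp_log hx]

/-- The threshold `s` is at most half of the mean `M * γ ^ 2 / 16`; the bound becomes `(2 / e) ^ s`.
-/
theorem chernoff_lower {γ : ℝ} (hγ1 : γ ≤ 1) (hγ : 0 < γ) {s M : ℕ}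
    (hM : 32 * s / γ ^ 2 ≤ M) :
    (2 : ℝ) ^ s * (1 - γ ^ 2 / 16 / 2) ^ M ≤ (3 / 4) ^ s := by
  have hγ2 : γ ^ 2 ≤ 1 := pow_le_one₀ hγ.le hγ1
  rw [div_le_iff₀ (by positivity)] at hM
  have h1 : (1 - γ ^ 2 / 16 / 2) ^ M ≤ Real.exp (-1) ^ s := by
    calc (1 - γ ^ 2 / 16 / 2) ^ M ≤ Real.exp (-(γ ^ 2 / 16 / 2)) ^ M :=
          pow_le_pow_left₀ (by linarith) (Real.one_sub_le_exp_neg _) M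
      _ = Real.exp (M * -(γ ^ 2 / 16 / 2)) := (Real.exp_nat_mul _ _).symm
      _ ≤ Real.exp (s * -1) := Real.exp_le_exp.2 (by linarith)
      _ = Real.exp (-1) ^ s := Real.exp_nat_mul _ _
  have h2 : 2 * Real.exp (-1) ≤ 3 / 4 := by
    have := Real.exp_one_gt_d9
    rw [Real.exp_neg, ← div_eq_mul_inv, div_le_iff₀ (Real.exp_pos 1)]
    linarith
  calc (2 : ℝ) ^ s * (1 - γ ^ 2 / 16 / 2) ^ M ≤ 2 ^ s * Real.exp (-1) ^ s := by gcongr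
    _ = (2 * Real.exp (-1)) ^ s := (mul_pow _ _ _).symm
    _ ≤ (3 / 4) ^ s := pow_le_pow_left₀ (by positivity) h2 s

/-- With the same `M`, rounded up, the mean `M * γ ^ 2 / 256` is at most `s / 4`, and `exp (1 / 4) ≤
3 / 2`. Rounding is paid for by `s ≥ 1`. -/
theorem chernoff_upper {γ : ℝ} (hγ1 : γ ≤ 1) (hγ : 0 < γ) {s M : ℕ} (hs : 1 ≤ s)
    (hM : M ≤ 32 * s / γ ^ 2 + 1) :
    ((2 : ℝ) ^ s)⁻¹ * (1 + γ ^ 2 / 256) ^ M ≤ (3 / 4) ^ s := by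
  have hγ2 : γ ^ 2 ≤ 1 := pow_le_one₀ hγ.le hγ1
  have hs' : (1 : ℝ) ≤ s := by exact_mod_cast hs
  have hM' : M * (γ ^ 2 / 256) ≤ s * (1 / 4) := by
    calc M * (γ ^ 2 / 256) ≤ (32 * s / γ ^ 2 + 1) * (γ ^ 2 / 256) := by gcongr
      _ = s / 8 + γ ^ 2 / 256 := by field_simp; ring
      _ ≤ s * (1 / 4) := by linarith
  have h1 : (1 + γ ^ 2 / 256) ^ M ≤ Real.exp (1 / 4) ^ s := by
    calc (1 + γ ^ 2 / 256) ^ M ≤ Real.exp (γ ^ 2 / 256) ^ M := by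
          refine pow_le_pow_left₀ (by positivity) ?_ M
          rw [add_comm]; exact Real.add_one_le_exp _
      _ = Real.exp (M * (γ ^ 2 / 256)) := (Real.exp_nat_mul _ _).symm
      _ ≤ Real.exp (s * (1 / 4)) := Real.exp_le_exp.2 hM'
      _ = Real.exp (1 / 4) ^ s := Real.exp_nat_mul _ _
  have h2 : Real.exp (1 / 4) ≤ 3 / 2 := by
    have h := Real.one_sub_le_exp_neg (1 / 4)
    rw [Real.exp_neg] at h
    have h' := inv_anti₀ (by norm_num) h
    rw [inv_inv] at h'
    refine h'.trans ?_
    norm_num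
  calc ((2 : ℝ) ^ s)⁻¹ * (1 + γ ^ 2 / 256) ^ M ≤ (2 ^ s)⁻¹ * (3 / 2) ^ s := by
        gcongr
        exact h1.trans (pow_le_pow_left₀ (Real.exp_pos _).le h2 s)
    _ = (3 / 4) ^ s := by rw [← inv_pow, ← mul_pow]; norm_num

theorem one_le_lg (z : ℝ) : 1 ≤ lg z := le_max_left _ _

theorem log_le_lg (z : ℝ) : Real.log z ≤ lg z := le_max_right _ _

theorem lg_mono {x y : ℝ} (hx : 0 < x) (h : x ≤ y) : lg x ≤ lg y :=
  max_le_max le_rfl (Real.log_le_log hx h)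

theorem log_four_le : Real.log 4 ≤ 3 / 2 := by
  have : (4 : ℝ) = 2 ^ 2 := by norm_num
  rw [this, Real.log_pow]
  have := Real.log_two_lt_d9
  push_cast; linarith

/-- The slack `4` comes from `ε ≤ π ≤ 4`, which holds whenever any bisection step is made. -/
theorem lg_le_three_mul_lg {x y : ℝ} (hx : 0 < x) (hy : 0 < y) (h : x ≤ 4 * y) :
    lg x ≤ 3 * lg y := by
  have h1 := Real.log_le_log hx h
  rw [Real.log_mul (by norm_num) hy.ne'] at h1
  have := log_four_le
  have := one_le_lg y
  have := log_le_lg y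
  exact max_le (by linarith) (by linarith)

/-- The number of bisection steps. -/
theorem exists_steps {ε : ℝ} (hε : 0 < ε) :
    ∃ J : ℕ, (19 / 20) ^ J * Real.pi ≤ ε ∧ (∀ j < J, ε ≤ (19 / 20) ^ j * Real.pi) ∧
      (J : ℝ) ≤ 51 * lg ε⁻¹ := by
  classical
  have hpi := Real.pi_pos
  have hex : ∃ J : ℕ, (19 / 20) ^ J * Real.pi ≤ ε := by
    obtain ⟨J, hJ⟩ := exists_pow_lt_of_lt_one (show 0 < ε / Real.pi by positivity)
      (show (19 / 20 : ℝ) < 1 by norm_num)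
    exact ⟨J, by rw [lt_div_iff₀ hpi] at hJ; exact hJ.le⟩
  have hmin : ∀ j < Nat.find hex, ε ≤ (19 / 20) ^ j * Real.pi := fun j hj =>
    (not_le.1 (Nat.find_min hex hj)).le
  refine ⟨Nat.find hex, Nat.find_spec hex, hmin, ?_⟩
  generalize Nat.find hex = J at hmin
  rcases J with _ | J
  · have := one_le_lg ε⁻¹
    push_cast; linarith
  -- Minimality at the preceding step, with `19 / 20 ≤ exp (-1 / 20)`, bounds the number of steps by
  -- `20 * log (4 / ε) + 1`.
  · have h1 := hmin J (Nat.lt_succ_self J)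
    have h2 : (19 / 20 : ℝ) ≤ Real.exp (-(1 / 20)) := by
      have := Real.add_one_le_exp (-(1 / 20) : ℝ)
      linarith
    have h3 : ε ≤ Real.exp (J * -(1 / 20)) * 4 := by
      rw [Real.exp_nat_mul]
      refine h1.trans ?_
      have := Real.pi_le_four
      gcongr
    have h4 := Real.log_le_log hε h3
    rw [Real.log_mul (Real.exp_pos _).ne' (by norm_num), Real.log_exp] at h4
    have h5 := log_le_lg ε⁻¹
    rw [Real.log_inv] at h5
    have := one_le_lg ε⁻¹
    have := log_four_le
    push_cast
    linarith

theorem log_eight_div_le {γ : ℝ} (hγ : 0 < γ) : Real.log (8 / γ) ≤ 9 / 4 + lg γ⁻¹ := by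
  have h8 : (8 : ℝ) = 2 ^ 3 := by norm_num
  rw [div_eq_mul_inv, Real.log_mul (by norm_num) (inv_ne_zero hγ.ne'), h8, Real.log_pow]
  have := Real.log_two_lt_d9
  have := log_le_lg γ⁻¹
  push_cast
  linarith

/-- The cost of the search in terms of the logarithms `a`, `b`, `c` of `ε⁻¹`, `ϑ⁻¹`, `γ⁻¹`. -/
theorem exists_estimation_algorithm {ε γ ϑ : ℝ} (hε : 0 < ε) (hγ : 0 < γ) (hγ1 : γ ≤ 1)
    (hϑ : 0 < ϑ) :
    ∃ (P : Algorithm) (J M K : ℕ),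
      (∀ (n : ℕ) (η : ℝ) (H U UI : Matrix (Bits n) (Bits n) ℂ) (energy : ℝ) (ψ : Bits n → ℂ),
        0 ≤ η → IsEstimationInstance η γ H U UI energy ψ →
          1 - ϑ ≤ P.prob U UI {a : ℝ | |a - energy| ≤ ε}) ∧
      P.evolutionQueries ≤ J * (M * K) ∧ P.prepQueries ≤ J * M ∧
      P.oneQubitGates ≤ J * (M * K) ∧ P.queryDepth ≤ K ∧
      (J ≠ 0 → ε ≤ 4) ∧ (J : ℝ) ≤ 51 * lg ε⁻¹ ∧
      (M : ℝ) ≤ 6721 * (lg ε⁻¹ * lg ϑ⁻¹ * (γ ^ 2)⁻¹) ∧ (K : ℝ) ≤ 560 * (lg γ⁻¹ * ε⁻¹) := by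
  have hpi := Real.pi_pos
  have ha := one_le_lg ε⁻¹
  have hb := one_le_lg ϑ⁻¹
  have hc := one_le_lg γ⁻¹
  obtain ⟨J, hJ1, hJ2, hJ3⟩ := exists_steps hε
  obtain ⟨t, ht⟩ : ∃ t, t = ⌈4 * Real.log (8 / γ)⌉₊ := ⟨_, rfl⟩
  have ht34 : (3 / 4 : ℝ) ^ t ≤ γ / 8 := by
    rw [← inv_div 8 γ]
    exact three_quarters_pow_le (by positivity) (ht ▸ Nat.le_ceil _)
  have htle : (t : ℝ) ≤ 14 * lg γ⁻¹ := by
    have h0 : 0 ≤ Real.log (8 / γ) :=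
      Real.log_nonneg (by rw [le_div_iff₀ hγ]; linarith)
    have h1 := (Nat.ceil_lt_add_one (show 0 ≤ 4 * Real.log (8 / γ) by positivity)).le
    rw [← ht] at h1
    linarith [log_eight_div_le hγ]
  obtain ⟨circ, hcirc⟩ := exists_bisection_circuit t hγ hγ1 ht34
  have hx : 0 < ((J : ℝ) + 1) / ϑ := by positivity
  -- Each of the `J` steps may fail with probability `ϑ / (J + 1)`, which also makes sense for `J =
  -- 0`; the final `+ 1` ensures `s ≥ 1`.
  obtain ⟨s, hs⟩ : ∃ s, s = ⌈4 * Real.log ((J + 1) / ϑ)⌉₊ + 1 := ⟨_, rfl⟩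
  have hs34 : (3 / 4 : ℝ) ^ s ≤ ϑ / (J + 1) := by
    rw [← inv_div ((J : ℝ) + 1) ϑ]
    refine three_quarters_pow_le hx ((Nat.le_ceil _).trans ?_)
    rw [hs]; push_cast; linarith
  have hsle : (s : ℝ) ≤ 210 * (lg ε⁻¹ * lg ϑ⁻¹) := by
    -- The crude bound `log (J + 1) ≤ J` costs only one more logarithm of `ε⁻¹`.
    have h1 : Real.log ((J + 1) / ϑ) ≤ J + lg ϑ⁻¹ := by
      rw [div_eq_mul_inv, Real.log_mul (by positivity) (inv_ne_zero hϑ.ne')]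
      have := Real.log_le_sub_one_of_pos (show (0 : ℝ) < J + 1 by positivity)
      linarith [log_le_lg ϑ⁻¹]
    have h2 : (⌈4 * Real.log ((J + 1) / ϑ)⌉₊ : ℝ) ≤ 4 * (J + lg ϑ⁻¹) + 1 := by
      refine le_trans (b := (⌈4 * (J + lg ϑ⁻¹)⌉₊ : ℝ)) ?_
        (Nat.ceil_lt_add_one (by positivity)).le
      exact Nat.cast_le.2 (Nat.ceil_mono (by linarith))
    rw [hs]; push_cast
    nlinarith [mul_nonneg (sub_nonneg.2 ha) (sub_nonneg.2 hb)]
  obtain ⟨M, hM⟩ : ∃ M, M = ⌈32 * s / γ ^ 2⌉₊ := ⟨_, rfl⟩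
  have hMlow : 32 * s / γ ^ 2 ≤ M := hM ▸ Nat.le_ceil _
  have hMup : M ≤ 32 * s / γ ^ 2 + 1 := hM ▸ (Nat.ceil_lt_add_one (by positivity)).le
  obtain ⟨K, hK⟩ : ∃ K, K = ⌊40 * t / ε⌋₊ := ⟨_, rfl⟩
  have hKge : ∀ {m : ℕ} {W : ℝ}, ε ≤ W → (m : ℝ) ≤ 40 * t / W → m ≤ K := fun hW hm => by
    rw [hK]
    exact Nat.le_floor (hm.trans (by gcongr))
  refine ⟨search circ M s J 0 Real.pi, J, M, K, ?_, ?_, ?_, ?_, ?_, ?_, hJ3, ?_, ?_⟩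
  · intro n η H U UI energy ψ hη h
    have h0 := (h.spectrum_subset h.ground_energy.1)
    have h1 := le_prob_search h.evolution_unitary h.prep_unitary circ M s
      (p₀ := γ ^ 2 / 256) (p₁ := γ ^ 2 / 16) (energy := energy) (δ := ϑ / (J + 1)) (by positivity)
      ((chernoff_lower hγ1 hγ hMlow).trans hs34)
      ((chernoff_upper hγ1 hγ (by omega) hMup).trans hs34)
      (fun L W hL hW hWpi hLe _ => (hcirc L W hW hWpi).2.2.2 n η H U UI energy ψ hη h hL hLe)
      J 0 Real.pi le_rfl hpi le_rfl (by linarith [h0.1]) (by linarith [h0.2])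
    refine le_trans ?_ (h1.trans (prob_mono U UI _ fun a ha => le_trans ha hJ1))
    have h2 : J * (ϑ / (J + 1)) ≤ ϑ := by
      rw [mul_div_assoc', div_le_iff₀ (by positivity)]
      linarith
    linarith
  · exact total_search_le _ circ M s K
      (fun L W hW hWpi => hKge hW (hcirc L W (hε.trans_le hW) hWpi).1) J 0 _ hJ2 hpi.le le_rfl
  · have := total_search_le Gate.isPrep circ M s 1
      (fun L W hW hWpi => (hcirc L W (hε.trans_le hW) hWpi).2.1) J 0 _ hJ2 hpi.le le_rfl
    rwa [mul_one] at this
  · exact total_search_le _ circ M s K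
      (fun L W hW hWpi => hKge hW (hcirc L W (hε.trans_le hW) hWpi).2.2.1) J 0 _ hJ2 hpi.le le_rfl
  · exact maxPerRun_search_le _ circ M s K
      (fun L W hW hWpi => hKge hW (hcirc L W (hε.trans_le hW) hWpi).1) J 0 _ hJ2 hpi.le le_rfl
  · intro hJ
    have := hJ2 0 (Nat.pos_of_ne_zero hJ)
    rw [pow_zero, one_mul] at this
    exact this.trans Real.pi_le_four
  · have hγ2 : 1 ≤ (γ ^ 2)⁻¹ := (one_le_inv₀ (by positivity)).2 (pow_le_one₀ hγ.le hγ1)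
    refine hMup.trans ?_
    have h1 : 1 ≤ lg ε⁻¹ * lg ϑ⁻¹ := one_le_mul_of_one_le_of_one_le ha hb
    have h2 : 1 ≤ lg ε⁻¹ * lg ϑ⁻¹ * (γ ^ 2)⁻¹ := one_le_mul_of_one_le_of_one_le h1 hγ2
    have h3 : 32 * s / γ ^ 2 ≤ 32 * (210 * (lg ε⁻¹ * lg ϑ⁻¹)) * (γ ^ 2)⁻¹ := by
      rw [div_eq_mul_inv]; gcongr
    linarith
  · rw [hK]
    refine (Nat.floor_le (by positivity)).trans ?_
    calc 40 * t / ε ≤ 40 * (14 * lg γ⁻¹) / ε := by gcongr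
      _ = 560 * (lg γ⁻¹ * ε⁻¹) := by ring

end QETU

theorem theorem2 :
    ∃ (C : ℝ) (k : ℕ), 0 < C ∧
      ∀ η ε γ ϑ : ℝ, 0 < η → 0 < ε → 0 < γ → γ ≤ 1 → 0 < ϑ → ϑ < 1 →
        ∃ P : QETU.Algorithm,
          -- correctness, for every instance of the problem
          (∀ (n : ℕ) (H U UI : Matrix (QETU.Bits n) (QETU.Bits n) ℂ) (energy : ℝ)
              (ψ : QETU.Bits n → ℂ),
            QETU.IsEstimationInstance η γ H U UI energy ψ →
              1 - ϑ ≤ P.prob U UI {a : ℝ | |a - energy| ≤ ε}) ∧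
          -- queries to (controlled) `U`
          (P.evolutionQueries : ℝ) ≤
            C * (ε⁻¹ * (γ ^ 2)⁻¹ * QETU.lg ϑ⁻¹) *
              QETU.lg (ε⁻¹ * (γ ^ 2)⁻¹ * QETU.lg ϑ⁻¹) ^ k ∧
          -- queries to `U_I`
          (P.prepQueries : ℝ) ≤ C * (γ ^ 2)⁻¹ * QETU.lg (ε⁻¹ * ϑ⁻¹) ^ k ∧
          -- additional one-qubit gates
          (P.oneQubitGates : ℝ) ≤
            C * (ε⁻¹ * (γ ^ 2)⁻¹ * QETU.lg ϑ⁻¹) *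
              QETU.lg (ε⁻¹ * (γ ^ 2)⁻¹ * QETU.lg ϑ⁻¹) ^ k ∧
          -- query depth of `U`
          (P.queryDepth : ℝ) ≤ C * ε⁻¹ * QETU.lg γ⁻¹ := by
  -- The constant covers `51 * 6721 * 560 * 3 = 575855280`. In the evolution cost, the three
  -- logarithms besides that of `ϑ⁻¹` come from the number of steps, the repetitions per step and
  -- the degree of the filter.
  refine ⟨10 ^ 9, 3, by norm_num, fun η ε γ ϑ hη hε hγ hγ1 hϑ hϑ1 => ?_⟩
  obtain ⟨P, J, M, K, hP, hev, hprep, hone, hdepth, hJ0, hJ, hM, hK⟩ :=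
    QETU.exists_estimation_algorithm hε hγ hγ1 hϑ
  have ha := QETU.one_le_lg ε⁻¹
  have hb := QETU.one_le_lg ϑ⁻¹
  have hc := QETU.one_le_lg γ⁻¹
  have hγ2 : 1 ≤ (γ ^ 2)⁻¹ := (one_le_inv₀ (by positivity)).2 (pow_le_one₀ hγ.le hγ1)
  have hϑ2 : 1 ≤ ϑ⁻¹ := (one_le_inv₀ hϑ).2 hϑ1.le
  have hε0 : 0 < ε⁻¹ := inv_pos.2 hε
  obtain ⟨g, hg⟩ : ∃ g, g = ε⁻¹ * (γ ^ 2)⁻¹ * QETU.lg ϑ⁻¹ := ⟨_, rfl⟩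
  have hg0 : 0 < g := by rw [hg]; positivity
  have hG := QETU.one_le_lg g
  rw [← hg]
  have hcost : ((J * (M * K) : ℕ) : ℝ) ≤ 10 ^ 9 * g * QETU.lg g ^ 3 := by
    -- For large `ε` the quantity `g` may be small while `γ⁻¹` is large, but then no step is made
    -- and the cost is zero. Otherwise `ε ≤ 4`, and `lg γ⁻¹` is controlled by `lg g`.
    by_cases hJz : J = 0
    · rw [hJz, zero_mul, Nat.cast_zero]; positivity
    have hε4 := hJ0 hJz
    have ha' : QETU.lg ε⁻¹ ≤ QETU.lg g := by
      refine QETU.lg_mono hε0 ?_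
      rw [hg, mul_assoc]
      exact le_mul_of_one_le_right hε0.le (one_le_mul_of_one_le_of_one_le hγ2 hb)
    have hc' : QETU.lg γ⁻¹ ≤ 3 * QETU.lg g := by
      refine QETU.lg_le_three_mul_lg (inv_pos.2 hγ) hg0 ?_
      have h1 : γ⁻¹ ≤ (γ ^ 2)⁻¹ := inv_anti₀ (by positivity) (by nlinarith)
      have h2 : 1 ≤ 4 * ε⁻¹ := by
        rw [← div_eq_mul_inv, le_div_iff₀ hε]; linarith
      have h3 : (γ ^ 2)⁻¹ ≤ (γ ^ 2)⁻¹ * (4 * ε⁻¹ * QETU.lg ϑ⁻¹) :=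
        le_mul_of_one_le_right (by positivity) (one_le_mul_of_one_le_of_one_le h2 hb)
      rw [hg]
      linarith
    push_cast
    calc (J : ℝ) * (M * K) ≤ 51 * QETU.lg ε⁻¹ * (6721 * (QETU.lg ε⁻¹ * QETU.lg ϑ⁻¹ *
          (γ ^ 2)⁻¹) * (560 * (QETU.lg γ⁻¹ * ε⁻¹))) := by gcongr
      _ = 191951760 * g * (QETU.lg ε⁻¹ * QETU.lg ε⁻¹ * QETU.lg γ⁻¹) := by rw [hg]; ring
      _ ≤ 191951760 * g * (QETU.lg g * QETU.lg g * (3 * QETU.lg g)) := by gcongr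
      _ = 575855280 * (g * QETU.lg g ^ 3) := by ring
      _ ≤ 10 ^ 9 * (g * QETU.lg g ^ 3) := by gcongr; norm_num
      _ = 10 ^ 9 * g * QETU.lg g ^ 3 := by ring
  refine ⟨P, fun n H U UI energy ψ h => hP n η H U UI energy ψ hη.le h,
    le_trans (by exact_mod_cast hev) hcost, ?_, le_trans (by exact_mod_cast hone) hcost, ?_⟩
  · refine le_trans (b := ((J * M : ℕ) : ℝ)) (by exact_mod_cast hprep) ?_
    have hh := QETU.one_le_lg (ε⁻¹ * ϑ⁻¹)
    by_cases hJz : J = 0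
    · rw [hJz, zero_mul, Nat.cast_zero]; positivity
    have hε4 := hJ0 hJz
    have ha' : QETU.lg ε⁻¹ ≤ QETU.lg (ε⁻¹ * ϑ⁻¹) :=
      QETU.lg_mono hε0 (le_mul_of_one_le_right hε0.le hϑ2)
    have hb' : QETU.lg ϑ⁻¹ ≤ 3 * QETU.lg (ε⁻¹ * ϑ⁻¹) := by
      refine QETU.lg_le_three_mul_lg (inv_pos.2 hϑ) (by positivity) ?_
      have h2 : 1 ≤ 4 * ε⁻¹ := by
        rw [← div_eq_mul_inv, le_div_iff₀ hε]; linarith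
      rw [← mul_assoc]
      exact le_mul_of_one_le_left (by positivity) h2
    push_cast
    calc (J : ℝ) * M ≤ 51 * QETU.lg ε⁻¹ * (6721 * (QETU.lg ε⁻¹ * QETU.lg ϑ⁻¹ *
          (γ ^ 2)⁻¹)) := by gcongr
      _ = 342771 * (γ ^ 2)⁻¹ * (QETU.lg ε⁻¹ * QETU.lg ε⁻¹ * QETU.lg ϑ⁻¹) := by ring
      _ ≤ 342771 * (γ ^ 2)⁻¹ * (QETU.lg (ε⁻¹ * ϑ⁻¹) * QETU.lg (ε⁻¹ * ϑ⁻¹) *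
          (3 * QETU.lg (ε⁻¹ * ϑ⁻¹))) := by gcongr
      _ = 1028313 * ((γ ^ 2)⁻¹ * QETU.lg (ε⁻¹ * ϑ⁻¹) ^ 3) := by ring
      _ ≤ 10 ^ 9 * ((γ ^ 2)⁻¹ * QETU.lg (ε⁻¹ * ϑ⁻¹) ^ 3) := by gcongr; norm_num
      _ = 10 ^ 9 * (γ ^ 2)⁻¹ * QETU.lg (ε⁻¹ * ϑ⁻¹) ^ 3 := by ring
  · refine le_trans (by exact_mod_cast hdepth) (hK.trans ?_)
    calc 560 * (QETU.lg γ⁻¹ * ε⁻¹) ≤ 10 ^ 9 * (QETU.lg γ⁻¹ * ε⁻¹) := by gcongr; norm_num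
      _ = 10 ^ 9 * ε⁻¹ * QETU.lg γ⁻¹ := by ring
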